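/- **Setting.** Let $\mathbb S_n$ be the set of permutations of $[n]=\{1,\dots,n\}$ and $\mathbb S=\bigsqcup_{n\ge1}\mathbb S_n$. For $\sigma\in\mathbb S_k,\pi\in\mathbb S_n$ with $k\le n$ let $t(\sigma,\pi)$ be the proportion of strictly increasing maps $f:[k]\to[n]$ with $\sigma(i)<\sigma(j)\Leftrightarrow\pi(f(i))<\pi(f(j))$ for all $i,j\in[k]$; put $t(\sigma,\pi)=0$ if $k>n$. The pattern frequency compactification $\bar{\mathbb S}$ is the closure of $\mathbb S$, embedded in $[0,1]^{\mathbb S}$ by $\pi\mapsto t(\cdot,\pi)$, in the product topology. A copula $C$ is the distribution function of a probability measure on $[0,1]^2$ with uniform marginals. For data $z_i=(x_i,y_i)$, $i\le n$, without ties in either component, the associated permutation is $\pi_y\circ\pi_x^{-1}\in\mathbb S_n$, where $\pi_x(i),\pi_y(i)$ are the ranks of $x_i$ among $x_1,\dots,x_n$ and of $y_i$ among $y_1,\dots,y_n$; how ties are broken is irrelevant, as they have probability $0$ below. For $\sigma\in\mathbb S_k$, $t(\sigma,C)$ is the probability that the permutation associated with $k$ independent points with distribution function $C$ is $\sigma$.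 The process $\Pi=(\Pi_n)_{n\ge1}$ generated by $C$ is obtained from independent random points $Z_1,Z_2,\dots$ with distribution function $C$, $\Pi_n$ being the permutation associated with $Z_1,\dots,Z_n$. The double-insertion chain $\Pi^{\mathrm H}$ starts at the unique element of $\mathbb S_1$; $\Pi^{\mathrm H}_{n+1}$ is obtained from $\Pi^{\mathrm H}_n$ by inserting a value $J_n$ at position $I_n$ and increasing the values $\ge J_n$ of $\Pi^{\mathrm H}_n$ by $1$, where all $I_n,J_n$ are independent and uniform on $[n+1]$. Put $p^{\mathrm H}(\sigma,\tau)=P(\Pi^{\mathrm H}_{n+1}=\tau\mid\Pi^{\mathrm H}_n=\sigma)$ for $\sigma\in\mathbb S_n$, $\tau\in\mathbb S_{n+1}$. For a Markov chain $X=(X_n)_{n\ge1}$ with $X_n\in\mathbb S_n$, let $S_X=\bigsqcup_n\{x\in\mathbb S_n:P(X_n=x)>0\}$ be its state space. Its Martin kernel is $K(x,y)=P(X_n=y\mid X_m=x)/P(X_n=y)$ for $x\in S_X\cap\mathbb S_m$, $y\in S_X\cap\mathbb S_n$, $m\le n$, and $K(x,y)=0$ if $m>n$. Put $f_x(y)=P(X_m=x)K(x,y)$.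 The Doob–Martin compactification $\bar S_X$ is the closure of $S_X$, embedded in $[0,1]^{S_X}$ by $y\mapsto(f_x(y))_{x\in S_X}$, and the Martin boundary is $\bar S_X\setminus S_X$. **Theorem.** Let $C$ be a copula and $\Pi$ the process generated by $C$. 1. $\Pi$ is a Markov chain, and for all $n\ge1$, $\sigma\in\mathbb S_n$ with $P(\Pi_n=\sigma)>0$ and $\tau\in\mathbb S_{n+1}$ one has $t(\sigma,C)>0$ and $$P(\Pi_{n+1}=\tau\mid\Pi_n=\sigma)=\frac{(n+1)\,t(\tau,C)}{t(\sigma,C)}\,p^{\mathrm H}(\sigma,\tau).$$ 2. The Doob–Martin topology of $\Pi$ is the pattern frequency topology: there is a homeomorphism, equal to the identity on the state space $S_\Pi$, from the Doob–Martin compactification of $\Pi$ onto the closure of $S_\Pi$ in $\bar{\mathbb S}$ (which is $\bar{\mathbb S}$ if $S_\Pi=\mathbb S$). 3. $\Pi$ is a Doob $h$-transform of $\Pi^{\mathrm H}$. More precisely: the state space of $\Pi^{\mathrm H}$ is $\mathbb S$, and its Doob–Martin compactification is homeomorphic to $\bar{\mathbb S}$ by a map that is the identity on $\mathbb S$. For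 each $\sigma\in\mathbb S$ the Martin kernel $K(\sigma,\cdot)$ of $\Pi^{\mathrm H}$ extends continuously to this compactification. The function $t(\cdot,C)$ is a point of the boundary $\bar{\mathbb S}\setminus\mathbb S$; denoting this point by $C$, one has $$K(\sigma,C)=k!\,t(\sigma,C)\qquad\text{for all }k\ge1,\ \sigma\in\mathbb S_k.$$ The function $h=K(\cdot,C)$ is nonnegative and harmonic for $\Pi^{\mathrm H}$, i.e. $h(\sigma)=\sum_{\tau\in\mathbb S_{n+1}}p^{\mathrm H}(\sigma,\tau)h(\tau)$ for $\sigma\in\mathbb S_n$; moreover $P(\Pi_1=\sigma)=h(\sigma)P(\Pi^{\mathrm H}_1=\sigma)$ for $\sigma\in\mathbb S_1$, both $\Pi$ and $\Pi^{\mathrm H}$ are Markov chains, and $h(\sigma)>0$ and $$P(\Pi_{n+1}=\tau\mid\Pi_n=\sigma)=\frac{K(\tau,C)}{K(\sigma,C)}\,p^{\mathrm H}(\sigma,\tau)$$ for all $n\ge1$, $\sigma\in\mathbb S_n$ with $P(\Pi_n=\sigma)>0$ and $\tau\in\mathbb S_{n+1}$. -/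

import Mathlib

open MeasureTheory ProbabilityTheory Filter Topology Set

noncomputable section

/-! ### Permutations and patterns -/

/-- The set of all permutations of `[n]`, `n ≥ 1`. Permutations of `[n]` are modelled as
permutations of `Fin n`, that is, positions and values are counted from `0`. -/
structure AllPerm where
  size : ℕ
  size_pos : 1 ≤ size
  perm : Equiv.Perm (Fin size)

/-- The relative frequency `t(σ, π)` of the pattern `σ` in the permutation `π`: the proportion of
strictly increasing maps `f : [k] → [n]` with `σ i < σ j ↔ π (f i) < π (f j)`.
It is `0` if `k > n` (then both numerator and denominator vanish). -/
def patternFreq {k n : ℕ} (σ : Equiv.Perm (Fin k)) (π : Equiv.Perm (Fin n)) : ℝ :=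
  (Nat.card {f : Fin k ↪o Fin n // ∀ i j, σ i < σ j ↔ π (f i) < π (f j)} : ℝ) / (n.choose k : ℝ)

/-- A permutation `π` regarded as the function `σ ↦ t(σ, π)` on the set of all permutations. -/
def patternEmb (π : AllPerm) : AllPerm → ℝ := fun σ => patternFreq σ.perm π.perm

/-- The closure of a set `T` of permutations in the pattern frequency topology, i.e. in the
product space of functions on the set of all permutations. All coordinates of the embedded points
lie in `[0,1]`, so this is the closure in the cube. For `T = univ` it is the compactification of
the set of all permutations in the pattern frequency topology. -/
def patternClosure (T : Set AllPerm) : Set (AllPerm → ℝ) := closure (patternEmb '' T)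

/-- The rank permutation of `x`: it sends `i` to the rank of `x i` among `x 0, …, x (n-1)`
(see `rankPerm_val`; ties are broken by the index). -/
def rankPerm {n : ℕ} {α : Type*} [LinearOrder α] (x : Fin n → α) : Equiv.Perm (Fin n) :=
  (Tuple.sort x)⁻¹

/-- Without ties `rankPerm x i` is the number of `j` with `x j < x i`, that is, the rank of `x i`,
counted from `0`. -/
theorem rankPerm_val {n : ℕ} {α : Type*} [LinearOrder α] (x : Fin n → α)
    (hx : Function.Injective x) (i : Fin n) :
    (rankPerm x i : ℕ) = (Finset.univ.filter fun j => x j < x i).card := by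
  have hs : StrictMono (x ∘ Tuple.sort x) :=
    (Tuple.monotone_sort x).strictMono_of_injective (hx.comp (Tuple.sort x).injective)
  have h : (Finset.univ.filter fun j => x j < x i)
      = (Finset.Iio (rankPerm x i)).map (Tuple.sort x).toEmbedding := by
    ext j
    simp only [Finset.mem_filter, Finset.mem_univ, true_and, Finset.mem_map_equiv, Finset.mem_Iio]
    have h1 := hs.lt_iff_lt (a := (Tuple.sort x).symm j) (b := (Tuple.sort x).symm i)
    simp only [Function.comp_apply, Equiv.apply_symm_apply] at h1
    exact h1
  rw [h, Finset.card_map, Fin.card_Iio]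

/-- The permutation `π_y ∘ π_x⁻¹` relating the orders of the two components of the data
`z 0, …, z (n-1)`. -/
def orderPerm {n : ℕ} {α : Type*} [LinearOrder α] (z : Fin n → α × α) : Equiv.Perm (Fin n) :=
  rankPerm (fun i => (z i).2) * (rankPerm fun i => (z i).1)⁻¹

/-! ### Copulas -/

/-- A (two-dimensional) copula: the distribution function of a probability measure on the unit
square with uniform marginals. -/
structure Copula where
  toFun : unitInterval → unitInterval → unitInterval
  exists_measure : ∃ μ : Measure (unitInterval × unitInterval), IsProbabilityMeasure μ ∧
    ∀ u v, μ.real (Iic u ×ˢ Iic v) = (toFun u v : ℝ)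
  right_one : ∀ u, toFun u 1 = u
  left_one : ∀ v, toFun 1 v = v

/-- The probability measure on the unit square with distribution function `C`. -/
def Copula.measure (C : Copula) : Measure (unitInterval × unitInterval) := C.exists_measure.choose

instance (C : Copula) : IsProbabilityMeasure C.measure := C.exists_measure.choose_spec.1

theorem Copula.measure_real (C : Copula) (u v : unitInterval) :
    C.measure.real (Iic u ×ˢ Iic v) = (C.toFun u v : ℝ) := C.exists_measure.choose_spec.2 u v

/-- The pattern frequency `t(σ, C)`: the probability that a sample of size `k` from `C`
leads to the permutation `σ`. -/
def copulaFreq (C : Copula) {k : ℕ} (σ : Equiv.Perm (Fin k)) : ℝ :=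
  (Measure.pi fun _ : Fin k => C.measure).real {z | orderPerm z = σ}

/-- The process of permutations `Π_n` associated with the first `n` of the points
`Z 0, Z 1, …`. -/
def generatedProcess {Ω : Type*} (Z : ℕ → Ω → unitInterval × unitInterval) (n : ℕ) (ω : Ω) : Equiv.Perm (Fin n) :=
  orderPerm fun i : Fin n => Z i ω

/-! ### Double insertion -/

/-- Insert the value `j` at position `i` and increase the appropriate values by one. -/
def insertPerm {n : ℕ} (σ : Equiv.Perm (Fin n)) (i j : Fin (n + 1)) : Equiv.Perm (Fin (n + 1)) :=
  (finSuccEquiv' i).trans ((Equiv.optionCongr σ).trans (finSuccEquiv' j).symm)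

theorem insertPerm_self {n : ℕ} (σ : Equiv.Perm (Fin n)) (i j : Fin (n + 1)) :
    insertPerm σ i j i = j := by
  simp [insertPerm]

theorem insertPerm_succAbove {n : ℕ} (σ : Equiv.Perm (Fin n)) (i j : Fin (n + 1)) (m : Fin n) :
    insertPerm σ i j (i.succAbove m) = j.succAbove (σ m) := by
  simp [insertPerm]

/-- The process `Π^H` driven by the insertion positions `A n` and inserted values `B n`, which
are used in the step from `n` to `n + 1`. Its value at time `1` is the only permutation of
size one. -/
def doubleInsertion {Ω : Type*} (A B : (n : ℕ) → Ω → Fin (n + 1)) :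
    (n : ℕ) → Ω → Equiv.Perm (Fin n)
  | 0, _ => 1
  | n + 1, ω => insertPerm (doubleInsertion A B n ω) (A n ω) (B n ω)

/-! ### Markov chains of permutations, started at time `1`, and their Martin boundary -/

section Chain

variable {Ω : Type*} [MeasurableSpace Ω] (P : Measure Ω) (X : (n : ℕ) → Ω → Equiv.Perm (Fin n))

/-- `P(X_{n+1} = τ | X_n = σ)`. -/
def transProb {n : ℕ} (σ : Equiv.Perm (Fin n)) (τ : Equiv.Perm (Fin (n + 1))) : ℝ :=
  (P[|{ω | X n ω = σ}]).real {ω | X (n + 1) ω = τ}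

/-- `X_1, X_2, …` is a Markov chain. -/
def IsMarkovChain : Prop :=
  ∀ n : ℕ, 1 ≤ n → ∀ (s : (k : ℕ) → Equiv.Perm (Fin k)) (τ : Equiv.Perm (Fin (n + 1))),
    P {ω | ∀ k, 1 ≤ k → k ≤ n → X k ω = s k} ≠ 0 →
    (P[|{ω | ∀ k, 1 ≤ k → k ≤ n → X k ω = s k}]).real {ω | X (n + 1) ω = τ}
      = transProb P X (s n) τ

/-- The (minimal) state space of the chain: the permutations `x` with `P(X_n = x) > 0`, where `n`
is the size of `x`. -/
def stateSpace : Set AllPerm := {x | P {ω | X x.size ω = x.perm} ≠ 0}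

/-- The Martin kernel `K(x, y) = P(X_n = y | X_m = x) / P(X_n = y)` for `x` of size `m` and `y` of
size `n ≥ m`, and `K(x, y) = 0` otherwise. -/
def martinKernel (x y : AllPerm) : ℝ :=
  if x.size ≤ y.size then
    (P[|{ω | X x.size ω = x.perm}]).real {ω | X y.size ω = y.perm}
      / P.real {ω | X y.size ω = y.perm}
  else 0

/-- The embedding `y ↦ (f_x(y))_x` of the state space that defines the Doob-Martin
compactification, where `f_x(y) = P(X_m = x) K(x, y) ∈ [0,1]`. -/
def martinEmb (y : stateSpace P X) : stateSpace P X → ℝ :=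
  fun x => P.real {ω | X x.1.size ω = x.1.perm} * martinKernel P X x y

/-- The Doob-Martin compactification of the state space. -/
def martinCompactification : Set (stateSpace P X → ℝ) := closure (range (martinEmb P X))

theorem martinEmb_mem (y : stateSpace P X) : martinEmb P X y ∈ martinCompactification P X :=
  subset_closure (mem_range_self y)

/-- The Martin boundary. -/
def martinBoundary : Set (stateSpace P X → ℝ) :=
  martinCompactification P X \ range (martinEmb P X)

/-- The Martin kernel extended to the compactification: `K(x, α)` is the limit of `K(x, y)` as the
state `y` converges to `α` in the Doob-Martin topology. -/
def martinKernelExt (x : AllPerm) (α : stateSpace P X → ℝ) : ℝ :=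
  limUnder (comap (martinEmb P X) (𝓝 α)) fun y => martinKernel P X x y

/-- `Φ` identifies the Doob-Martin compactification with the closure of the state space in the
pattern frequency topology, and is the identity on the state space. -/
def IsIdentification
    (Φ : martinCompactification P X ≃ₜ patternClosure (stateSpace P X)) : Prop :=
  ∀ y : stateSpace P X,
    (Φ ⟨martinEmb P X y, martinEmb_mem P X y⟩ : AllPerm → ℝ) = patternEmb y

/-- The chain `X` (under `P`) is Doob's `h`-transform of the chain `Y` (under `Q`), where `h` is a
nonnegative harmonic function for `Y`. -/
def IsHTransform {Ω' : Type*} [MeasurableSpace Ω'] (Q : Measure Ω')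
    (Y : (n : ℕ) → Ω' → Equiv.Perm (Fin n)) (h : AllPerm → ℝ) : Prop :=
  IsMarkovChain Q Y ∧ IsMarkovChain P X ∧
  (∀ x ∈ stateSpace Q Y, 0 ≤ h x) ∧
  (∀ x ∈ stateSpace Q Y,
    h x = ∑ τ, transProb Q Y x.perm τ * h ⟨x.size + 1, Nat.le_add_left 1 x.size, τ⟩) ∧
  (∀ σ : Equiv.Perm (Fin 1),
    P.real {ω | X 1 ω = σ} = h ⟨1, le_rfl, σ⟩ * Q.real {ω | Y 1 ω = σ}) ∧
  ∀ x ∈ stateSpace P X, ∀ τ : Equiv.Perm (Fin (x.size + 1)),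
    0 < h x ∧ transProb P X x.perm τ
      = h ⟨x.size + 1, Nat.le_add_left 1 x.size, τ⟩ / h x * transProb Q Y x.perm τ

end Chain

end

/-! Both chains have the same backward dynamics: given `X (n + 1)`, the permutation `X n` arises by
deleting a uniformly chosen position (`IsDeletionChain`). Iterated deletions leave a uniformly
chosen set of positions, so P(X_m = σ | X_n = τ) = t(σ, τ) (`measureReal_inter`, resting on
`sum_patternFreq_deletePerm`). Hence P(X_m = σ) K(σ, τ) = t(σ, τ): the Doob-Martin coordinates are
pattern frequencies. Patterns outside the state space have frequency zero in every state, so the two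
closures agree (`exists_isIdentification`).

With d(σ, τ) the number of positions of τ whose deletion gives σ, P(X_{n+1} = τ | X_n = σ) is d(σ,
τ)/(n+1) · P(X_{n+1} = τ)/P(X_n = σ). The weights are t(σ, C) for Π and 1/n! for the double
insertion chain, so the transition probabilities differ by a quotient of values of h(σ) = k! t(σ,
C).

That Π is a deletion chain follows from exchangeability: the ranks of the first components are
uniform and independent of Π_n. The ranks together with Π_n determine the past, whereas the number
of ways to reach τ does not depend on them (`card_deletePerm_eq`).

The point t(·, C) lies in the closure because the mean of t(σ, Π_n) over disjoint blocks of the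
sample obeys a law of large numbers (`tendsto_sum_abs_patternFreq_sub`). It is no permutation, as
its values over each size sum to 1. -/

/-! ### Deletion of a position -/

/-- Delete the entry at position `i` and decrease the larger values by one. -/
def deletePerm {n : ℕ} (τ : Equiv.Perm (Fin (n + 1))) (i : Fin (n + 1)) : Equiv.Perm (Fin n) :=
  Equiv.removeNone (((finSuccEquiv' i).symm.trans τ).trans (finSuccEquiv' (τ i)))

/-- The working description of `deletePerm`: since `succAbove` is injective and monotone, this
equation determines the deletion and its order relations. -/
theorem succAbove_deletePerm {n : ℕ} (τ : Equiv.Perm (Fin (n + 1))) (i : Fin (n + 1))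
    (m : Fin n) : (τ i).succAbove (deletePerm τ i m) = τ (i.succAbove m) := by
  have h : ((((finSuccEquiv' i).symm.trans τ).trans (finSuccEquiv' (τ i))) (some m)).isSome := by
    have hne : τ (i.succAbove m) ≠ τ i := fun h => Fin.succAbove_ne i m (τ.injective h)
    obtain ⟨l, hl⟩ := Fin.exists_succAbove_eq hne
    simp [← hl]
  have h2 := Equiv.removeNone_some _ (Option.isSome_iff_exists.mp h)
  have h3 := congrArg (finSuccEquiv' (τ i)).symm h2
  simpa [deletePerm] using h3

theorem insertPerm_eq_iff {n : ℕ} (σ : Equiv.Perm (Fin n)) (τ : Equiv.Perm (Fin (n + 1)))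
    (i j : Fin (n + 1)) : insertPerm σ i j = τ ↔ τ i = j ∧ deletePerm τ i = σ := by
  constructor
  · rintro rfl
    refine ⟨insertPerm_self σ i j, Equiv.ext fun m => ?_⟩
    have h := succAbove_deletePerm (insertPerm σ i j) i m
    rw [insertPerm_self, insertPerm_succAbove] at h
    exact Fin.succAbove_right_injective h
  · rintro ⟨rfl, rfl⟩
    refine Equiv.ext fun l => ?_
    rcases eq_or_ne l i with rfl | hl
    · exact insertPerm_self _ _ _
    · obtain ⟨m, rfl⟩ := Fin.exists_succAbove_eq hl
      rw [insertPerm_succAbove, succAbove_deletePerm]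

/-- Removing a point from the graph of ρ at `i` removes the point of τ at `ρ i`. This transfers
deletions from the two rank permutations to `orderPerm`. -/
theorem deletePerm_mul {n : ℕ} (τ ρ : Equiv.Perm (Fin (n + 1))) (i : Fin (n + 1)) :
    deletePerm (τ * ρ) i = deletePerm τ (ρ i) * deletePerm ρ i := by
  refine Equiv.ext fun m => Fin.succAbove_right_injective (p := τ (ρ i)) ?_
  have h := succAbove_deletePerm (τ * ρ) i m
  rw [Equiv.Perm.mul_apply] at h
  rw [h, Equiv.Perm.mul_apply, Equiv.Perm.mul_apply, succAbove_deletePerm, succAbove_deletePerm]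

/-- The number of positions of `τ` whose deletion leads to `σ`. -/
def deletionCount {n : ℕ} (σ : Equiv.Perm (Fin n)) (τ : Equiv.Perm (Fin (n + 1))) : ℕ :=
  (Finset.univ.filter fun i => deletePerm τ i = σ).card

theorem sum_deletionCount_mul {n : ℕ} (τ : Equiv.Perm (Fin (n + 1)))
    (f : Equiv.Perm (Fin n) → ℝ) :
    ∑ σ, (deletionCount σ τ : ℝ) * f σ = ∑ i, f (deletePerm τ i) := by
  rw [← Finset.sum_fiberwise (s := Finset.univ) (g := deletePerm τ)]
  refine Finset.sum_congr rfl fun σ _ => ?_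
  rw [Finset.sum_congr rfl (g := fun _ => f σ), Finset.sum_const, nsmul_eq_mul, deletionCount]
  intro i hi
  rw [(Finset.mem_filter.mp hi).2]

theorem card_insertPerm_eq {n : ℕ} (σ : Equiv.Perm (Fin n)) (τ : Equiv.Perm (Fin (n + 1))) :
    (Finset.univ.filter fun p : Fin (n + 1) × Fin (n + 1) => insertPerm σ p.1 p.2 = τ).card
      = deletionCount σ τ := by
  symm
  refine Finset.card_bij (fun i _ => (i, τ i)) ?_ ?_ ?_
  · intro i hi
    simpa [insertPerm_eq_iff] using hi
  · intro i _ j _ h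
    exact congrArg Prod.fst h
  · rintro ⟨i, j⟩ h
    simp only [Finset.mem_filter, Finset.mem_univ, true_and, insertPerm_eq_iff] at h
    exact ⟨i, by simp [h.2], by simp [h.1]⟩

/-- A permutation with prescribed deletion ρ at `l` is determined by its free value i at `l`, and
the second condition restricts only i. The count is thus independent of ρ and `l`, which is the
source of the Markov property of Π. -/
theorem card_deletePerm_eq {n : ℕ} (σ ρ : Equiv.Perm (Fin n)) (τ : Equiv.Perm (Fin (n + 1)))
    (l : Fin (n + 1)) :
    (Finset.univ.filter fun ρ' : Equiv.Perm (Fin (n + 1)) =>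
      deletePerm ρ' l = ρ ∧ deletePerm τ (ρ' l) = σ).card = deletionCount σ τ := by
  symm
  refine Finset.card_bij (fun i _ => insertPerm ρ l i) ?_ ?_ ?_
  · intro i hi
    have h := (insertPerm_eq_iff ρ (insertPerm ρ l i) l i).mp rfl
    simpa [h.1, h.2] using hi
  · intro i _ j _ h
    rw [← insertPerm_self ρ l i, h, insertPerm_self]
  · intro ρ' h
    simp only [Finset.mem_filter, Finset.mem_univ, true_and] at h
    exact ⟨ρ' l, by simpa using h.2, (insertPerm_eq_iff _ _ _ _).mpr ⟨rfl, h.1⟩⟩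

/-! ### Pattern frequencies -/

theorem patternFreq_of_lt {k n : ℕ} (h : n < k) (σ : Equiv.Perm (Fin k))
    (π : Equiv.Perm (Fin n)) : patternFreq σ π = 0 := by
  simp [patternFreq, Nat.choose_eq_zero_of_lt h]

/-- The quotient `ρ' * ρ⁻¹` is an order automorphism of a finite chain, hence the identity. -/
theorem perm_eq_of_lt_iff_lt {n : ℕ} {ρ ρ' : Equiv.Perm (Fin n)}
    (h : ∀ i j, ρ i < ρ j ↔ ρ' i < ρ' j) : ρ = ρ' := by
  have hm : StrictMono (ρ' * ρ⁻¹) := fun a b hab => by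
    have := (h (ρ⁻¹ a) (ρ⁻¹ b)).mp (by simpa using hab)
    simpa using this
  let e : Fin n ≃o Fin n := hm.orderIsoOfSurjective _ (ρ' * ρ⁻¹).surjective
  have he : e = OrderIso.refl _ := Subsingleton.elim _ _
  refine Equiv.ext fun i => ?_
  have := congrArg (fun e : Fin n ≃o Fin n => e (ρ i)) he
  simpa [e] using this.symm

theorem patternFreq_same_size {n : ℕ} (σ π : Equiv.Perm (Fin n)) :
    patternFreq σ π = if σ = π then 1 else 0 := by
  have key : ∀ f : Fin n ↪o Fin n, ∀ i, f i = i := fun f i => by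
    let e : Fin n ≃o Fin n :=
      f.strictMono.orderIsoOfSurjective _ (Finite.surjective_of_injective f.injective)
    have he : e = OrderIso.refl _ := Subsingleton.elim _ _
    exact congrArg (fun e : Fin n ≃o Fin n => e i) he
  unfold patternFreq
  split_ifs with h
  · subst h
    have : Unique {f : Fin n ↪o Fin n // ∀ i j, σ i < σ j ↔ σ (f i) < σ (f j)} :=
      ⟨⟨⟨RelEmbedding.refl _, fun _ _ => Iff.rfl⟩⟩, fun f => Subtype.ext <| by
        ext i
        simp [key]⟩
    simp
  · have : IsEmpty {f : Fin n ↪o Fin n // ∀ i j, σ i < σ j ↔ π (f i) < π (f j)} :=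
      ⟨fun f => h <| perm_eq_of_lt_iff_lt fun i j => by simpa [key] using f.2 i j⟩
    simp

/-- Double counting of pairs of an occurrence of σ in τ and a position it misses: such an occurrence
survives the deletion of that position. -/
theorem card_occurrences_mul {k n : ℕ} (σ : Equiv.Perm (Fin k))
    (τ : Equiv.Perm (Fin (n + 1))) :
    Nat.card {f : Fin k ↪o Fin (n + 1) // ∀ i j, σ i < σ j ↔ τ (f i) < τ (f j)} * (n + 1 - k)
      = ∑ l, Nat.card {f : Fin k ↪o Fin n //
          ∀ i j, σ i < σ j ↔ deletePerm τ l (f i) < deletePerm τ l (f j)} := by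
  have hlt (l : Fin (n + 1)) (a b : Fin n) :
      deletePerm τ l a < deletePerm τ l b ↔ τ (l.succAbove a) < τ (l.succAbove b) := by
    rw [← succAbove_deletePerm, ← succAbove_deletePerm, Fin.succAbove_lt_succAbove_iff]
  rw [← Nat.card_sigma]
  let S := {f : Fin k ↪o Fin (n + 1) // ∀ i j, σ i < σ j ↔ τ (f i) < τ (f j)}
  have e : (Σ f : S, {l : Fin (n + 1) // l ∉ Set.range f.1}) ≃
      (Σ l : Fin (n + 1), {f : Fin k ↪o Fin n //
          ∀ i j, σ i < σ j ↔ deletePerm τ l (f i) < deletePerm τ l (f j)}) := by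
    symm
    refine Equiv.ofBijective (fun p => ⟨⟨p.2.1.trans (Fin.succAboveOrderEmb p.1), fun i j => ?_⟩,
      p.1, ?_⟩) ⟨?_, ?_⟩
    · rw [p.2.2 i j, hlt]
      rfl
    · rintro ⟨i, hi⟩
      exact Fin.succAbove_ne _ _ hi
    · rintro ⟨l, f, hf⟩ ⟨l', f', hf'⟩ h
      simp only [Sigma.mk.injEq] at h
      obtain ⟨h1, h2⟩ := h
      have hl : l = l' := by
        have : ∀ g g' : S, g = g' → ∀ (a b : Fin (n + 1)) (ha : a ∉ Set.range g.1)
            (hb : b ∉ Set.range g'.1),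
            HEq (⟨a, ha⟩ : {l : Fin (n + 1) // l ∉ Set.range g.1})
              (⟨b, hb⟩ : {l : Fin (n + 1) // l ∉ Set.range g'.1}) → a = b := by
          rintro g _ rfl a b ha hb h
          exact congrArg Subtype.val (eq_of_heq h)
        exact this _ _ h1 _ _ _ _ h2
      subst hl
      have hff : f = f' := by
        ext i
        have h3 := congrArg (fun g : S => g.1 i) h1
        rw [show f i = f' i by simpa using h3]
      subst hff
      rfl
    · rintro ⟨⟨f, hf⟩, l, hl⟩
      have hne : ∀ i, f i ≠ l := fun i h => hl ⟨i, h⟩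
      choose g hg using fun i => Fin.exists_succAbove_eq (hne i)
      let g' : Fin k ↪o Fin n := OrderEmbedding.ofStrictMono g fun a b hab => by
        rw [← Fin.succAbove_lt_succAbove_iff (p := l), hg, hg]
        exact f.strictMono hab
      have hfg : g'.trans (Fin.succAboveOrderEmb l) = f := by
        ext i
        exact congrArg Fin.val (hg i)
      have hl' := hl
      exact ⟨⟨l, g', fun i j => by rw [hf i j, hlt, ← hfg]; rfl⟩,
        Sigma.subtype_ext (Subtype.ext hfg) rfl⟩
  rw [← Nat.card_congr e, Nat.card_sigma, Finset.sum_congr rfl (g := fun _ => n + 1 - k)]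
  · simp [S, Nat.card_eq_fintype_card]
  · intro f _
    have h1 : Nat.card {l : Fin (n + 1) // l ∉ Set.range f.1} = (Set.range f.1)ᶜ.ncard := rfl
    rw [h1, Set.ncard_compl, ← Set.image_univ, Set.ncard_image_of_injective _ f.1.injective]
    simp

/-- A uniform k-subset of what remains after a uniform deletion is a uniform k-subset of all
positions. For k = n + 1 this fails, as the left side vanishes. -/
theorem sum_patternFreq_deletePerm {k n : ℕ} (hk : k ≤ n) (σ : Equiv.Perm (Fin k))
    (τ : Equiv.Perm (Fin (n + 1))) :
    ∑ l, patternFreq σ (deletePerm τ l) = ((n : ℝ) + 1) * patternFreq σ τ := by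
  have h := card_occurrences_mul σ τ
  have hc : (n.choose k : ℝ) ≠ 0 := by exact_mod_cast (Nat.choose_pos hk).ne'
  have hc' : ((n + 1).choose k : ℝ) ≠ 0 := by
    exact_mod_cast (Nat.choose_pos (Nat.le_succ_of_le hk)).ne'
  unfold patternFreq
  rw [← Finset.sum_div, ← Nat.cast_sum, ← h]
  have h2 : (n.choose k : ℝ) * (n + 1) = (n + 1).choose k * ((n + 1 - k : ℕ) : ℝ) := by
    exact_mod_cast Nat.choose_mul_succ_eq n k
  rw [Nat.cast_mul, ← mul_div_assoc, div_eq_div_iff hc hc']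
  linear_combination (-(Nat.card {f : Fin k ↪o Fin (n + 1) //
    ∀ i j, σ i < σ j ↔ τ (f i) < τ (f j)} : ℝ)) * h2

/-! ### Chains of permutations whose backward steps delete a uniformly chosen position -/

/-- Total probability over the values of V; restricting the measure to `E` avoids measurability of
`E`. -/
theorem sum_measureReal_inter_fiber {Ω ι : Type*} [MeasurableSpace Ω] [Fintype ι]
    (P : Measure Ω) [IsFiniteMeasure P] {V : Ω → ι}
    (hV : ∀ v, MeasurableSet {ω | V ω = v}) (E : Set Ω) :
    ∑ v, P.real (E ∩ {ω | V ω = v}) = P.real E := by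
  have h := sum_measureReal_preimage_singleton (μ := P.restrict E) Finset.univ (f := V)
    (fun v _ => hV v)
  rw [Finset.coe_univ, preimage_univ, measureReal_restrict_apply_univ] at h
  rw [← h]
  refine Finset.sum_congr rfl fun v _ => ?_
  rw [inter_comm]
  exact (measureReal_restrict_apply (hV v)).symm

theorem cond_real_apply_eq_div {Ω : Type*} [MeasurableSpace Ω] (P : Measure Ω) {s : Set Ω}
    (hs : MeasurableSet s) (t : Set Ω) : (P[|s]).real t = P.real (s ∩ t) / P.real s := by
  rw [measureReal_def, cond_apply hs, ENNReal.toReal_mul, ENNReal.toReal_inv, div_eq_inv_mul]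
  rfl

/-- `X` is a Markov chain of permutations such that, given `X (n + 1)`, the permutation `X n`
results from the deletion of a uniformly chosen position. -/
structure IsDeletionChain {Ω : Type*} [MeasurableSpace Ω] (P : Measure Ω)
    (X : (n : ℕ) → Ω → Equiv.Perm (Fin n)) : Prop where
  measurableSet_eq : ∀ n σ, MeasurableSet {ω | X n ω = σ}
  markov : ∀ n, 1 ≤ n → ∀ (S : Set ((k : Fin (n + 1)) → Equiv.Perm (Fin k)))
    (σ : Equiv.Perm (Fin n)) (τ : Equiv.Perm (Fin (n + 1))),
    P.real ({ω | (fun k : Fin (n + 1) => X k ω) ∈ S} ∩ {ω | X n ω = σ} ∩ {ω | X (n + 1) ω = τ})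
        * P.real {ω | X n ω = σ}
      = P.real ({ω | (fun k : Fin (n + 1) => X k ω) ∈ S} ∩ {ω | X n ω = σ})
        * P.real ({ω | X n ω = σ} ∩ {ω | X (n + 1) ω = τ})
  joint : ∀ n, 1 ≤ n → ∀ (σ : Equiv.Perm (Fin n)) (τ : Equiv.Perm (Fin (n + 1))),
    P.real ({ω | X n ω = σ} ∩ {ω | X (n + 1) ω = τ})
      = deletionCount σ τ / ((n : ℝ) + 1) * P.real {ω | X (n + 1) ω = τ}

namespace IsDeletionChain

variable {Ω : Type*} [MeasurableSpace Ω] {P : Measure Ω} {X : (n : ℕ) → Ω → Equiv.Perm (Fin n)}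

theorem transProb_eq (hX : IsDeletionChain P X) {n : ℕ} (hn : 1 ≤ n) (σ : Equiv.Perm (Fin n))
    (τ : Equiv.Perm (Fin (n + 1))) :
    transProb P X σ τ = deletionCount σ τ / ((n : ℝ) + 1) * P.real {ω | X (n + 1) ω = τ}
      / P.real {ω | X n ω = σ} := by
  rw [transProb, cond_real_apply_eq_div P (hX.measurableSet_eq n σ), hX.joint n hn]

variable [IsProbabilityMeasure P]

theorem isMarkovChain (hX : IsDeletionChain P X) : IsMarkovChain P X := by
  intro n hn s τ h0
  let A : Set Ω := {ω | ∀ k, 1 ≤ k → k ≤ n → X k ω = s k}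
  have hA : A = {ω | (fun k : Fin (n + 1) => X k ω) ∈
      {h : (k : Fin (n + 1)) → Equiv.Perm (Fin k) | ∀ k : Fin (n + 1), 1 ≤ (k : ℕ) → h k = s k}}
      ∩ {ω | X n ω = s n} := by
    ext ω
    constructor
    · intro h
      exact ⟨fun k hk => h k hk (Nat.lt_succ_iff.mp k.2), h n hn le_rfl⟩
    · rintro ⟨h, -⟩ k hk hkn
      exact h ⟨k, Nat.lt_succ_of_le hkn⟩ hk
  have hAm : MeasurableSet A := by
    have : A = ⋂ k, ⋂ (_ : 1 ≤ k), ⋂ (_ : k ≤ n), {ω | X k ω = s k} := by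
      ext ω
      simp [A]
    rw [this]
    exact MeasurableSet.iInter fun k => MeasurableSet.iInter fun _ => MeasurableSet.iInter fun _ =>
      hX.measurableSet_eq k _
  have hA0 : P.real A ≠ 0 := by
    rw [measureReal_def]
    exact ENNReal.toReal_ne_zero.mpr ⟨h0, measure_ne_top _ _⟩
  have hs0 : P.real {ω | X n ω = s n} ≠ 0 := by
    intro h
    refine hA0 (le_antisymm ?_ measureReal_nonneg)
    rw [← h]
    exact measureReal_mono fun ω hω => hω n hn le_rfl
  have key := hX.markov n hn {h | ∀ k : Fin (n + 1), 1 ≤ (k : ℕ) → h k = s k} (s n) τ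
  rw [← hA] at key
  rw [transProb, cond_real_apply_eq_div P (hX.measurableSet_eq n _), cond_real_apply_eq_div P hAm,
    div_eq_div_iff hA0 hs0, key, mul_comm]

/-- Induction on n: split over the value σ' of `X n`, use the Markov property there, and average
t(σ, ·) over the deletions of τ. -/
theorem measureReal_inter (hX : IsDeletionChain P X) {m n : ℕ} (hm : 1 ≤ m) (hmn : m ≤ n)
    (σ : Equiv.Perm (Fin m)) (τ : Equiv.Perm (Fin n)) :
    P.real ({ω | X m ω = σ} ∩ {ω | X n ω = τ})
      = patternFreq σ τ * P.real {ω | X n ω = τ} := by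
  induction n, hmn using Nat.le_induction with
  | base =>
    rw [patternFreq_same_size]
    split_ifs with h
    · rw [h, inter_self, one_mul]
    · have : {ω | X m ω = σ} ∩ {ω | X m ω = τ} = ∅ := by
        ext ω
        simp only [mem_inter_iff, mem_ofPred_eq, mem_empty_iff_false, iff_false, not_and]
        rintro rfl
        exact h
      rw [this, measureReal_empty, zero_mul]
  | succ n hmn ih =>
    rw [← sum_measureReal_inter_fiber P (hX.measurableSet_eq n)]
    have key : ∀ σ' : Equiv.Perm (Fin n),
        P.real ({ω | X m ω = σ} ∩ {ω | X (n + 1) ω = τ} ∩ {ω | X n ω = σ'})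
          = deletionCount σ' τ * patternFreq σ σ'
            * (P.real {ω | X (n + 1) ω = τ} / ((n : ℝ) + 1)) := by
      intro σ'
      have h1 := hX.markov n (hm.trans hmn)
        {h | h ⟨m, Nat.lt_succ_of_le hmn⟩ = σ} σ' τ
      have h2 := hX.joint n (hm.trans hmn) σ' τ
      have h3 : {ω | (fun k : Fin (n + 1) => X k ω) ∈
        {h : (k : Fin (n + 1)) → Equiv.Perm (Fin k) | h ⟨m, Nat.lt_succ_of_le hmn⟩ = σ}}
          = {ω | X m ω = σ} := rfl
      rw [h3, ih] at h1
      rw [inter_right_comm]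
      have h4 : (deletionCount σ' τ : ℝ) * patternFreq σ σ'
            * (P.real {ω | X (n + 1) ω = τ} / ((n : ℝ) + 1))
          = patternFreq σ σ' * P.real ({ω | X n ω = σ'} ∩ {ω | X (n + 1) ω = τ}) := by
        rw [h2]
        ring
      rw [h4]
      -- The product form of the Markov property says nothing about null states; there both sides
      -- vanish.
      by_cases h0 : P.real {ω | X n ω = σ'} = 0
      · have h5 : P.real ({ω | X n ω = σ'} ∩ {ω | X (n + 1) ω = τ}) = 0 :=
          measureReal_mono_null inter_subset_left h0
        have h6 : P.real ({ω | X m ω = σ} ∩ {ω | X n ω = σ'} ∩ {ω | X (n + 1) ω = τ}) = 0 :=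
          measureReal_mono_null (inter_subset_left.trans inter_subset_right) h0
        rw [h5, h6, mul_zero]
      · refine mul_right_cancel₀ h0 ?_
        rw [h1]
        ring
    rw [Finset.sum_congr rfl fun σ' _ => key σ', ← Finset.sum_mul, sum_deletionCount_mul,
      sum_patternFreq_deletePerm hmn]
    field_simp

theorem measureReal_ne_zero {x : AllPerm} (hx : x ∈ stateSpace P X) :
    P.real {ω | X x.size ω = x.perm} ≠ 0 := by
  rw [measureReal_def]
  exact ENNReal.toReal_ne_zero.mpr ⟨hx, measure_ne_top _ _⟩

theorem martinKernel_eq (hX : IsDeletionChain P X) (x : AllPerm) {y : AllPerm}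
    (hy : y ∈ stateSpace P X) :
    martinKernel P X x y = patternFreq x.perm y.perm / P.real {ω | X x.size ω = x.perm} := by
  unfold martinKernel
  split_ifs with h
  · rw [cond_real_apply_eq_div P (hX.measurableSet_eq _ _), hX.measureReal_inter x.size_pos h]
    have := measureReal_ne_zero hy
    field_simp
  · rw [patternFreq_of_lt (not_le.mp h), zero_div]

theorem martinEmb_eq (hX : IsDeletionChain P X) (y x : stateSpace P X) :
    martinEmb P X y x = patternFreq x.1.perm y.1.perm := by
  have := measureReal_ne_zero x.2
  rw [martinEmb, hX.martinKernel_eq _ y.2]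
  field_simp

/-- Any pattern of a reachable permutation is itself reachable, by `measureReal_inter`. -/
theorem patternFreq_eq_zero (hX : IsDeletionChain P X) {x y : AllPerm}
    (hx : x ∉ stateSpace P X) (hy : y ∈ stateSpace P X) : patternFreq x.perm y.perm = 0 := by
  rcases lt_or_ge y.size x.size with h | h
  · exact patternFreq_of_lt h _ _
  · have h1 := hX.measureReal_inter x.size_pos h x.perm y.perm
    have hx0 : P {ω | X x.size ω = x.perm} = 0 := not_not.mp hx
    have h2 : P.real ({ω | X x.size ω = x.perm} ∩ {ω | X y.size ω = y.perm}) = 0 :=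
      measureReal_mono_null inter_subset_left (by rw [measureReal_def, hx0]; rfl)
    rw [h2] at h1
    exact (mul_eq_zero.mp h1.symm).resolve_right (measureReal_ne_zero hy)

open Classical in
-- Extension by zero `E` and restriction of coordinates `R` are continuous and mutually inverse on
-- the embedded states, hence on the closures. The last clause allows coordinates of boundary points
-- to be read off.
theorem exists_isIdentification (hX : IsDeletionChain P X) :
    ∃ Φ : martinCompactification P X ≃ₜ patternClosure (stateSpace P X),
      IsIdentification P X Φ ∧
      ∀ α, ∀ x : stateSpace P X, (Φ α : AllPerm → ℝ) x = α.1 x := by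
  let E : (stateSpace P X → ℝ) → AllPerm → ℝ :=
    fun g x => if h : x ∈ stateSpace P X then g ⟨x, h⟩ else 0
  let R : (AllPerm → ℝ) → stateSpace P X → ℝ := fun g x => g x
  have hE : Continuous E := continuous_pi fun x => by
    by_cases h : x ∈ stateSpace P X
    · simpa only [E, h, dite_true] using continuous_apply _
    · simpa only [E, h, dite_false] using continuous_const
  have hR : Continuous R := continuous_pi fun x => continuous_apply _
  have hRE : ∀ g, R (E g) = g := fun g => funext fun x => by simp [R, E]
  have hEm : ∀ y, E (martinEmb P X y) = patternEmb y := fun y => funext fun x => by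
    by_cases h : x ∈ stateSpace P X
    · simp only [E, h, dite_true, hX.martinEmb_eq, patternEmb]
    · simp only [E, h, dite_false, patternEmb, hX.patternFreq_eq_zero h y.2]
  have hRp : ∀ y : stateSpace P X, R (patternEmb y) = martinEmb P X y := fun y => by
    rw [← hEm, hRE]
  have hmE : MapsTo E (martinCompactification P X) (patternClosure (stateSpace P X)) :=
    MapsTo.closure (by rintro _ ⟨y, rfl⟩; exact ⟨y, y.2, (hEm y).symm⟩) hE
  have hmR : MapsTo R (patternClosure (stateSpace P X)) (martinCompactification P X) :=
    MapsTo.closure (by rintro _ ⟨y, hy, rfl⟩; exact ⟨⟨y, hy⟩, (hRp ⟨y, hy⟩).symm⟩) hR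
  have hER : patternClosure (stateSpace P X) ⊆ {g | E (R g) = g} := by
    refine closure_minimal ?_ (isClosed_eq (hE.comp hR) continuous_id)
    rintro _ ⟨y, hy, rfl⟩
    change E (R (patternEmb y)) = patternEmb y
    rw [hRp ⟨y, hy⟩, hEm]
  refine ⟨{ toFun := fun α => ⟨E α, hmE α.2⟩
            invFun := fun β => ⟨R β, hmR β.2⟩
            left_inv := fun α => Subtype.ext (hRE α)
            right_inv := fun β => Subtype.ext (hER β.2)
            continuous_toFun := (hE.comp continuous_subtype_val).subtype_mk _
            continuous_invFun := (hR.comp continuous_subtype_val).subtype_mk _ }, hEm, ?_⟩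
  intro α x
  exact congrFun (hRE α.1) x

end IsDeletionChain

/-! ### The double insertion chain -/

section DoubleInsertion

variable {Ω : Type*} {A B : (n : ℕ) → Ω → Fin (n + 1)}

theorem doubleInsertion_congr {ω ω' : Ω} {n : ℕ}
    (h : ∀ m < n, (A m ω, B m ω) = (A m ω', B m ω')) {k : ℕ} (hk : k ≤ n) :
    doubleInsertion A B k ω = doubleInsertion A B k ω' := by
  induction k with
  | zero => rfl
  | succ k ih =>
    have h1 := Prod.mk.inj (h k hk)
    rw [doubleInsertion, doubleInsertion, ih (Nat.le_of_succ_le hk), h1.1, h1.2]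

/-- The event `E` is determined by the first `n` insertions. -/
def DependsOnInsertions (A B : (n : ℕ) → Ω → Fin (n + 1)) (n : ℕ) (E : Set Ω) : Prop :=
  ∀ ω ω', (∀ m < n, (A m ω, B m ω) = (A m ω', B m ω')) → ω ∈ E → ω' ∈ E

/-- Writing the event through a map into a finite space yields both its measurability and its
independence of the next insertion. -/
theorem DependsOnInsertions.eq_preimage {n : ℕ} {E : Set Ω} (hE : DependsOnInsertions A B n E) :
    E = (fun ω (m : Finset.range n) => (A m ω, B m ω)) ⁻¹'
      ((fun ω (m : Finset.range n) => (A m ω, B m ω)) '' E) := by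
  refine Subset.antisymm (subset_preimage_image _ _) ?_
  rintro ω ⟨ω', hω', h⟩
  exact hE ω' ω (fun m hm => congrFun h ⟨m, Finset.mem_range.mpr hm⟩) hω'

theorem dependsOnInsertions_eq (n : ℕ) (σ : Equiv.Perm (Fin n)) :
    DependsOnInsertions A B n {ω | doubleInsertion A B n ω = σ} := fun _ _ h hω =>
  (doubleInsertion_congr h le_rfl).symm.trans hω

theorem dependsOnInsertions_history (n : ℕ)
    (S : Set ((k : Fin (n + 1)) → Equiv.Perm (Fin k))) :
    DependsOnInsertions A B n {ω | (fun k : Fin (n + 1) => doubleInsertion A B k ω) ∈ S} := by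
  intro ω ω' h hω
  have : (fun k : Fin (n + 1) => doubleInsertion A B k ω')
      = fun k : Fin (n + 1) => doubleInsertion A B k ω :=
    funext fun k => (doubleInsertion_congr h (Nat.lt_succ_iff.mp k.2)).symm
  rw [mem_ofPred_eq, this]
  exact hω

variable [MeasurableSpace Ω]

theorem DependsOnInsertions.measurableSet (hA : ∀ n, Measurable (A n))
    (hB : ∀ n, Measurable (B n)) {n : ℕ} {E : Set Ω} (hE : DependsOnInsertions A B n E) :
    MeasurableSet E := by
  rw [hE.eq_preimage]
  have h : Measurable fun ω (m : Finset.range n) => (A m ω, B m ω) :=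
    measurable_pi_lambda _ fun m => (hA m).prodMk (hB m)
  exact h (Set.toFinite _).measurableSet

variable {Q : Measure Ω} [IsProbabilityMeasure Q]
  (hA_meas : ∀ n, Measurable (A n)) (hB_meas : ∀ n, Measurable (B n))
  (hA_unif : ∀ n i, Q.real {ω | A n ω = i} = 1 / ((n : ℝ) + 1))
  (hB_unif : ∀ n j, Q.real {ω | B n ω = j} = 1 / ((n : ℝ) + 1))
  (hAB_indep : ∀ n, IndepFun (A n) (B n) Q)
  (hsteps_indep : iIndepFun (fun n ω => (A n ω, B n ω)) Q)

include hA_meas hB_meas hA_unif hB_unif hAB_indep in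
theorem measureReal_insertion_mem (n : ℕ) (F : Finset (Fin (n + 1) × Fin (n + 1))) :
    Q.real {ω | (A n ω, B n ω) ∈ F} = F.card / ((n : ℝ) + 1) ^ 2 := by
  have h := sum_measureReal_preimage_singleton (μ := Q) F (f := fun ω => (A n ω, B n ω))
    (fun p _ => ((hA_meas n).prodMk (hB_meas n)) (measurableSet_singleton p))
  change Q.real ((fun ω => (A n ω, B n ω)) ⁻¹' F) = _
  rw [← h, Finset.sum_congr rfl (g := fun _ => 1 / ((n : ℝ) + 1) ^ 2), Finset.sum_const,
    nsmul_eq_mul, mul_one_div]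
  intro p _
  have h1 : (fun ω => (A n ω, B n ω)) ⁻¹' {p} = A n ⁻¹' {p.1} ∩ B n ⁻¹' {p.2} := by
    ext ω
    simp [Prod.ext_iff]
  have h2 := (hAB_indep n).measure_inter_preimage_eq_mul {p.1} {p.2}
    (measurableSet_singleton _) (measurableSet_singleton _)
  rw [h1, measureReal_def, h2, ENNReal.toReal_mul]
  have h3 := hA_unif n p.1
  have h4 := hB_unif n p.2
  rw [measureReal_def] at h3 h4
  change (Q {ω | A n ω = p.1}).toReal * (Q {ω | B n ω = p.2}).toReal = _
  rw [h3, h4, one_div_mul_one_div, sq]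

include hA_meas hB_meas hA_unif hB_unif hAB_indep hsteps_indep in
theorem measureReal_inter_doubleInsertion_succ {n : ℕ} {E : Set Ω}
    (hE : DependsOnInsertions A B n E) (σ : Equiv.Perm (Fin n)) (τ : Equiv.Perm (Fin (n + 1)))
    (hEσ : E ⊆ {ω | doubleInsertion A B n ω = σ}) :
    Q.real (E ∩ {ω | doubleInsertion A B (n + 1) ω = τ})
      = Q.real E * (deletionCount σ τ / ((n : ℝ) + 1) ^ 2) := by
  let F := Finset.univ.filter fun p : Fin (n + 1) × Fin (n + 1) => insertPerm σ p.1 p.2 = τ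
  have h1 : E ∩ {ω | doubleInsertion A B (n + 1) ω = τ}
      = E ∩ (fun ω => (A n ω, B n ω)) ⁻¹' F := by
    ext ω
    refine and_congr_right fun hω => ?_
    have : doubleInsertion A B n ω = σ := hEσ hω
    simp [F, doubleInsertion, this]
  have hind := hsteps_indep.indepFun_finset (Finset.range n) {n} (by simp)
    fun m => (hA_meas m).prodMk (hB_meas m)
  have hev : Measurable fun g : (i : ({n} : Finset ℕ)) → Fin (i + 1) × Fin (i + 1) =>
      (g ⟨n, Finset.mem_singleton_self n⟩ : Fin (n + 1) × Fin (n + 1)) := measurable_pi_apply _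
  have hind' := hind.comp measurable_id hev
  have h2 := hind'.measure_inter_preimage_eq_mul
    ((fun ω (m : Finset.range n) => (A m ω, B m ω)) '' E) F
    (Set.toFinite _).measurableSet F.measurableSet
  rw [Function.id_comp, ← hE.eq_preimage] at h2
  rw [h1, ← card_insertPerm_eq,
    ← measureReal_insertion_mem hA_meas hB_meas hA_unif hB_unif hAB_indep n F,
    measureReal_def, measureReal_def, measureReal_def, ← ENNReal.toReal_mul]
  exact congrArg ENNReal.toReal h2

include hA_meas hB_meas hA_unif hB_unif hAB_indep hsteps_indep in
-- Each permutation of size n + 1 has n + 1 deletions, counted with multiplicity, so uniformity is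
-- inherited.
theorem measureReal_doubleInsertion (n : ℕ) (σ : Equiv.Perm (Fin n)) :
    Q.real {ω | doubleInsertion A B n ω = σ} = 1 / (n.factorial : ℝ) := by
  induction n with
  | zero =>
    have : {ω | doubleInsertion A B 0 ω = σ} = univ :=
      eq_univ_of_forall fun ω => Subsingleton.elim _ _
    simp [this]
  | succ n ih =>
    rw [← sum_measureReal_inter_fiber Q
      (fun σ' => (dependsOnInsertions_eq n σ').measurableSet hA_meas hB_meas)]
    have h : ∀ σ' : Equiv.Perm (Fin n), Q.real ({ω | doubleInsertion A B (n + 1) ω = σ}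
        ∩ {ω | doubleInsertion A B n ω = σ'})
          = deletionCount σ' σ * (1 / (n.factorial : ℝ) / ((n : ℝ) + 1) ^ 2) := fun σ' => by
      rw [inter_comm, measureReal_inter_doubleInsertion_succ hA_meas hB_meas hA_unif hB_unif
        hAB_indep hsteps_indep (dependsOnInsertions_eq n σ') σ' σ subset_rfl, ih]
      ring
    rw [Finset.sum_congr rfl fun σ' _ => h σ', sum_deletionCount_mul, Finset.sum_const,
      Finset.card_univ, Fintype.card_fin, nsmul_eq_mul, Nat.factorial_succ]
    push_cast
    field_simp

include hA_meas hB_meas hA_unif hB_unif hAB_indep hsteps_indep in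
theorem isDeletionChain_doubleInsertion : IsDeletionChain Q (doubleInsertion A B) where
  measurableSet_eq n σ := (dependsOnInsertions_eq n σ).measurableSet hA_meas hB_meas
  markov n hn S σ τ := by
    have hE : DependsOnInsertions A B n
        ({ω | (fun k : Fin (n + 1) => doubleInsertion A B k ω) ∈ S}
          ∩ {ω | doubleInsertion A B n ω = σ}) := fun ω ω' h hω =>
      ⟨dependsOnInsertions_history n S ω ω' h hω.1, dependsOnInsertions_eq n σ ω ω' h hω.2⟩
    rw [measureReal_inter_doubleInsertion_succ hA_meas hB_meas hA_unif hB_unif hAB_indep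
        hsteps_indep hE σ τ inter_subset_right,
      measureReal_inter_doubleInsertion_succ hA_meas hB_meas hA_unif hB_unif hAB_indep
        hsteps_indep (dependsOnInsertions_eq n σ) σ τ subset_rfl]
    ring
  joint n hn σ τ := by
    rw [measureReal_inter_doubleInsertion_succ hA_meas hB_meas hA_unif hB_unif hAB_indep
        hsteps_indep (dependsOnInsertions_eq n σ) σ τ subset_rfl,
      measureReal_doubleInsertion hA_meas hB_meas hA_unif hB_unif hAB_indep hsteps_indep,
      measureReal_doubleInsertion hA_meas hB_meas hA_unif hB_unif hAB_indep hsteps_indep,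
      Nat.factorial_succ]
    push_cast
    field_simp

end DoubleInsertion

/-! ### Chains that are uniformly distributed on the permutations of each size -/

section Uniform

variable {Ω : Type*} [MeasurableSpace Ω] {Q : Measure Ω}
  {Y : (n : ℕ) → Ω → Equiv.Perm (Fin n)}

theorem stateSpace_eq_univ_of_uniform
    (hu : ∀ n (σ : Equiv.Perm (Fin n)), Q.real {ω | Y n ω = σ} = 1 / (n.factorial : ℝ)) :
    stateSpace Q Y = univ := by
  refine eq_univ_of_forall fun x h0 => ?_
  have h := hu x.size x.perm
  rw [measureReal_def, h0] at h
  have : (1 / (x.size.factorial : ℝ)) ≠ 0 := by positivity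
  exact this h.symm

variable [IsProbabilityMeasure Q]

theorem IsDeletionChain.martinKernel_eq_of_uniform (hY : IsDeletionChain Q Y)
    (hu : ∀ n (σ : Equiv.Perm (Fin n)), Q.real {ω | Y n ω = σ} = 1 / (n.factorial : ℝ))
    (x y : stateSpace Q Y) :
    martinKernel Q Y x y = x.1.size.factorial * martinEmb Q Y y x := by
  rw [hY.martinKernel_eq _ y.2, hu, hY.martinEmb_eq, div_div_eq_mul_div, div_one, mul_comm]

theorem IsDeletionChain.martinKernelExt_eq_of_uniform (hY : IsDeletionChain Q Y)
    (hu : ∀ n (σ : Equiv.Perm (Fin n)), Q.real {ω | Y n ω = σ} = 1 / (n.factorial : ℝ))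
    (x : stateSpace Q Y) {α : stateSpace Q Y → ℝ} (hα : α ∈ martinCompactification Q Y) :
    martinKernelExt Q Y x α = x.1.size.factorial * α x := by
  -- Membership in the closure makes the filter nontrivial, so that `limUnder` is the unique limit
  -- and not a default value.
  have : NeBot (comap (martinEmb Q Y) (𝓝 α)) := by
    rw [comap_neBot_iff_frequently]
    exact mem_closure_iff_frequently.mp hα
  refine Tendsto.limUnder_eq ?_
  simp_rw [hY.martinKernel_eq_of_uniform hu]
  exact (((continuous_apply x).tendsto α).comp tendsto_comap).const_mul _

end Uniform

/-! ### Rank permutations of data without ties -/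

section Ranks

variable {α β : Type*} [LinearOrder α] [LinearOrder β]

theorem rankPerm_lt_iff {n : ℕ} {x : Fin n → α} (hx : Function.Injective x) (i j : Fin n) :
    rankPerm x i < rankPerm x j ↔ x i < x j := by
  have hs : StrictMono (x ∘ Tuple.sort x) :=
    (Tuple.monotone_sort x).strictMono_of_injective (hx.comp (Tuple.sort x).injective)
  have h := hs.lt_iff_lt (a := rankPerm x i) (b := rankPerm x j)
  simpa [rankPerm] using h.symm

theorem rankPerm_eq_of_lt_iff {n : ℕ} {x : Fin n → α} (hx : Function.Injective x)
    {ρ : Equiv.Perm (Fin n)} (h : ∀ i j, ρ i < ρ j ↔ x i < x j) : rankPerm x = ρ :=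
  perm_eq_of_lt_iff_lt fun i j => (rankPerm_lt_iff hx i j).trans (h i j).symm

theorem rankPerm_congr {n : ℕ} {x : Fin n → α} {y : Fin n → β} (hx : Function.Injective x)
    (hy : Function.Injective y) (h : ∀ i j, x i < x j ↔ y i < y j) : rankPerm x = rankPerm y :=
  rankPerm_eq_of_lt_iff hx fun i j => (rankPerm_lt_iff hy i j).trans (h i j).symm

theorem rankPerm_comp_perm {n : ℕ} {x : Fin n → α} (hx : Function.Injective x)
    (g : Equiv.Perm (Fin n)) : rankPerm (fun i => x (g i)) = rankPerm x * g :=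
  rankPerm_eq_of_lt_iff (hx.comp g.injective) fun i j => rankPerm_lt_iff hx (g i) (g j)

theorem rankPerm_castSucc {n : ℕ} {x : Fin (n + 1) → α} (hx : Function.Injective x) :
    rankPerm (fun i : Fin n => x i.castSucc) = deletePerm (rankPerm x) (Fin.last n) := by
  refine rankPerm_eq_of_lt_iff (hx.comp (Fin.castSucc_injective n)) fun i j => ?_
  rw [← Fin.succAbove_lt_succAbove_iff (p := rankPerm x (Fin.last n)), succAbove_deletePerm,
    succAbove_deletePerm, rankPerm_lt_iff hx, Fin.succAbove_last]
  rfl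

/-- The data `z` have no ties in either component. -/
def NoTies {ι : Type*} (z : ι → α × α) : Prop :=
  Function.Injective (fun i => (z i).1) ∧ Function.Injective fun i => (z i).2

omit [LinearOrder α] in
theorem NoTies.comp {ι κ : Type*} {z : ι → α × α} (hz : NoTies z) {e : κ → ι}
    (he : Function.Injective e) : NoTies fun i => z (e i) :=
  ⟨hz.1.comp he, hz.2.comp he⟩

theorem orderPerm_mul_rankPerm {n : ℕ} (z : Fin n → α × α) :
    orderPerm z * rankPerm (fun i => (z i).1) = rankPerm fun i => (z i).2 := by
  simp [orderPerm]

theorem orderPerm_comp_perm {n : ℕ} {z : Fin n → α × α} (hz : NoTies z)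
    (g : Equiv.Perm (Fin n)) : orderPerm (fun i => z (g i)) = orderPerm z := by
  simp [orderPerm, rankPerm_comp_perm hz.1 g, rankPerm_comp_perm hz.2 g, mul_assoc]

/-- In the permutation, the last point sits at the position given by its rank in the first
component. -/
theorem orderPerm_castSucc {n : ℕ} {z : Fin (n + 1) → α × α} (hz : NoTies z) :
    orderPerm (fun i : Fin n => z i.castSucc)
      = deletePerm (orderPerm z) (rankPerm (fun i => (z i).1) (Fin.last n)) := by
  rw [orderPerm, rankPerm_castSucc hz.1, rankPerm_castSucc hz.2, ← orderPerm_mul_rankPerm,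
    deletePerm_mul, mul_inv_cancel_right]

/-- Only relative order matters, so the data may be replaced by their pairs of ranks; these depend
only on the first ranks and on `orderPerm z`. -/
theorem orderPerm_comp_eq {k n : ℕ} {z : Fin n → α × α} (hz : NoTies z) {e : Fin k → Fin n}
    (he : Function.Injective e) :
    orderPerm (fun i => z (e i)) = orderPerm fun i : Fin k =>
      (rankPerm (fun i => (z i).1) (e i),
        orderPerm z (rankPerm (fun i => (z i).1) (e i))) := by
  have h : ∀ j, orderPerm z (rankPerm (fun i => (z i).1) j) = rankPerm (fun i => (z i).2) j :=
    fun j => by rw [← orderPerm_mul_rankPerm, Equiv.Perm.mul_apply]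
  simp_rw [h]
  unfold orderPerm
  congr 1
  · exact rankPerm_congr (hz.2.comp he) ((Equiv.injective _).comp he) fun i j =>
      (rankPerm_lt_iff hz.2 _ _).symm
  · congr 1
    exact rankPerm_congr (hz.1.comp he) ((Equiv.injective _).comp he) fun i j =>
      (rankPerm_lt_iff hz.1 _ _).symm

end Ranks

theorem measurableSet_rankPerm_eq {n : ℕ} (ρ : Equiv.Perm (Fin n)) :
    MeasurableSet {x : Fin n → unitInterval | rankPerm x = ρ} := by
  have h : {x : Fin n → unitInterval | rankPerm x = ρ}
      = (⋂ i, ⋂ j, ⋂ (_ : i ≤ j), {x | x (ρ⁻¹ i) ≤ x (ρ⁻¹ j)}) ∩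
        ⋂ i, ⋂ j, ⋂ (_ : i < j), ({x | x (ρ⁻¹ i) = x (ρ⁻¹ j)}ᶜ ∪ {_x | ρ⁻¹ i < ρ⁻¹ j}) := by
    ext x
    have h1 : rankPerm x = ρ ↔ ρ⁻¹ = Tuple.sort x := by
      rw [rankPerm, inv_eq_iff_eq_inv, eq_comm]
    rw [mem_ofPred_eq, h1, Tuple.eq_sort_iff]
    simp only [mem_inter_iff, mem_iInter, mem_ofPred_eq, mem_union, mem_compl_iff, Monotone,
      Function.comp_apply, imp_iff_not_or]
  rw [h]
  refine .inter (.iInter fun i => .iInter fun j => .iInter fun _ => ?_)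
    (.iInter fun i => .iInter fun j => .iInter fun _ => .union (.compl ?_) (.const _))
  · exact measurableSet_le (measurable_pi_apply _) (measurable_pi_apply _)
  · exact measurableSet_eq_fun (measurable_pi_apply _) (measurable_pi_apply _)

theorem measurableSet_orderPerm_eq {n : ℕ} (σ : Equiv.Perm (Fin n)) :
    MeasurableSet {z : Fin n → unitInterval × unitInterval | orderPerm z = σ} := by
  have h : {z : Fin n → unitInterval × unitInterval | orderPerm z = σ}
      = ⋃ ρ, ((fun z i => (z i).1) ⁻¹' {x | rankPerm x = ρ}) ∩
        ((fun z i => (z i).2) ⁻¹' {x | rankPerm x = σ * ρ}) := by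
    ext z
    simp [orderPerm, mul_inv_eq_iff_eq_mul]
  rw [h]
  refine .iUnion fun ρ => .inter ?_ ?_
  · exact (measurable_pi_lambda _ fun i => measurable_fst.comp (measurable_pi_apply i))
      (measurableSet_rankPerm_eq _)
  · exact (measurable_pi_lambda _ fun i => measurable_snd.comp (measurable_pi_apply i))
      (measurableSet_rankPerm_eq _)

/-! ### Samples from a copula -/

theorem Copula.map_fst (C : Copula) : C.measure.map Prod.fst = volume := by
  have : IsProbabilityMeasure (C.measure.map Prod.fst) :=
    Measure.isProbabilityMeasure_map measurable_fst.aemeasurable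
  refine Measure.ext_of_Iic _ _ fun u => ?_
  rw [Measure.map_apply measurable_fst measurableSet_Iic, unitInterval.volume_Iic]
  have h := C.measure_real u 1
  have h1 : Iic u ×ˢ Iic (1 : unitInterval) = Prod.fst ⁻¹' Iic u := by
    ext p
    simp [Prod.le_def, unitInterval.le_one']
  rw [h1, C.right_one] at h
  rw [← h, ofReal_measureReal]

theorem Copula.map_snd (C : Copula) : C.measure.map Prod.snd = volume := by
  have : IsProbabilityMeasure (C.measure.map Prod.snd) :=
    Measure.isProbabilityMeasure_map measurable_snd.aemeasurable
  refine Measure.ext_of_Iic _ _ fun v => ?_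
  rw [Measure.map_apply measurable_snd measurableSet_Iic, unitInterval.volume_Iic]
  have h := C.measure_real 1 v
  have h1 : Iic (1 : unitInterval) ×ˢ Iic v = Prod.snd ⁻¹' Iic v := by
    ext p
    simp [Prod.le_def, unitInterval.le_one']
  rw [h1, C.left_one] at h
  rw [← h, ofReal_measureReal]

/-- Lower rectangles form a generating π-system, so the measure chosen for `C` is the law of any
point with this distribution function. -/
theorem Copula.eq_measure (C : Copula) (μ : Measure (unitInterval × unitInterval))
    [IsProbabilityMeasure μ] (h : ∀ u v, μ.real (Iic u ×ˢ Iic v) = (C.toFun u v : ℝ)) :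
    μ = C.measure := by
  have hsp : IsCountablySpanning (range (Iic : unitInterval → Set unitInterval)) :=
    ⟨fun _ => univ, fun _ => ⟨⊤, Iic_top⟩, iUnion_const _⟩
  have hg : (inferInstance : MeasurableSpace unitInterval)
      = MeasurableSpace.generateFrom (range Iic) :=
    (BorelSpace.measurable_eq).trans (borel_eq_generateFrom_Iic _)
  refine ext_of_generate_finite
    (image2 (· ×ˢ ·) (range (Iic : unitInterval → Set unitInterval)) (range Iic)) ?_
    (isPiSystem_Iic.prod isPiSystem_Iic) ?_ (by simp)
  · rw [← generateFrom_prod_eq hsp hsp, ← hg]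
  · rintro _ ⟨_, ⟨u, rfl⟩, _, ⟨v, rfl⟩, rfl⟩
    refine (measureReal_eq_measureReal_iff).mp ?_
    rw [h, C.measure_real]

theorem ae_ne_of_indepFun {Ω α : Type*} [MeasurableSpace Ω] [MeasurableSpace α]
    [MeasurableEq α] [MeasurableSingletonClass α] {P : Measure Ω} [IsProbabilityMeasure P]
    {μ : Measure α} [SFinite μ] [NullSingletonClass μ] {U V : Ω → α} (hU : Measurable U)
    (hV : Measurable V) (hUV : IndepFun U V P) (hUμ : P.map U = μ) (hVμ : P.map V = μ) :
    ∀ᵐ ω ∂P, U ω ≠ V ω := by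
  have h := (indepFun_iff_map_prod_eq_prod_map_map hU.aemeasurable hV.aemeasurable).mp hUV
  have hd : MeasurableSet {p : α × α | p.1 = p.2} :=
    measurableSet_eq_fun measurable_fst measurable_snd
  have h0 : (μ.prod μ) {p : α × α | p.1 = p.2} = 0 := by
    rw [Measure.measure_prod_null hd]
    refine Eventually.of_forall fun x => ?_
    have : Prod.mk x ⁻¹' {p : α × α | p.1 = p.2} = {x} := by
      ext y
      simp [eq_comm]
    exact (congrArg μ this).trans (measure_singleton x)
  rw [hUμ, hVμ] at h
  rw [← h, Measure.map_apply (hU.prodMk hV) hd] at h0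
  rw [ae_iff]
  simpa using h0

section Sample

variable {Ω : Type*} [MeasurableSpace Ω] {P : Measure Ω} [IsProbabilityMeasure P]
  {C : Copula} {Z : ℕ → Ω → unitInterval × unitInterval}

theorem map_eq_copula_measure {i : ℕ} (hZ : Measurable (Z i))
    (hZ_law : ∀ u v, P.real {ω | (Z i ω).1 ≤ u ∧ (Z i ω).2 ≤ v} = (C.toFun u v : ℝ)) :
    P.map (Z i) = C.measure := by
  have : IsProbabilityMeasure (P.map (Z i)) := Measure.isProbabilityMeasure_map hZ.aemeasurable
  refine C.eq_measure _ fun u v => ?_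
  rw [map_measureReal_apply hZ (measurableSet_Iic.prod measurableSet_Iic)]
  exact hZ_law u v

variable (hZ_meas : ∀ i, Measurable (Z i)) (hZ_indep : iIndepFun Z P)
  (hZ_map : ∀ i, P.map (Z i) = C.measure)

include hZ_meas hZ_indep hZ_map

theorem ae_noTies : ∀ᵐ ω ∂P, NoTies fun i => Z i ω := by
  have h : ∀ᵐ ω ∂P, ∀ i j, i ≠ j → (Z i ω).1 ≠ (Z j ω).1 ∧ (Z i ω).2 ≠ (Z j ω).2 := by
    rw [ae_all_iff]
    intro i
    rw [ae_all_iff]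
    intro j
    rw [eventually_imp_distrib_left]
    intro hij
    have hind := hZ_indep.indepFun hij
    have h1 : ∀ i, P.map (fun ω => (Z i ω).1) = volume := fun i => by
      rw [← C.map_fst, ← hZ_map i, Measure.map_map measurable_fst (hZ_meas i)]
      rfl
    have h2 : ∀ i, P.map (fun ω => (Z i ω).2) = volume := fun i => by
      rw [← C.map_snd, ← hZ_map i, Measure.map_map measurable_snd (hZ_meas i)]
      rfl
    exact (ae_ne_of_indepFun (hZ_meas i).fst (hZ_meas j).fst
      (hind.comp measurable_fst measurable_fst) (h1 i) (h1 j)).and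
      (ae_ne_of_indepFun (hZ_meas i).snd (hZ_meas j).snd
      (hind.comp measurable_snd measurable_snd) (h2 i) (h2 j))
  filter_upwards [h] with ω hω
  exact ⟨fun i j hij => by_contra fun hne => (hω i j hne).1 hij,
    fun i j hij => by_contra fun hne => (hω i j hne).2 hij⟩

theorem map_sample {n : ℕ} {e : Fin n → ℕ} (he : Function.Injective e) :
    P.map (fun ω i => Z (e i) ω) = Measure.pi fun _ => C.measure := by
  rw [(iIndepFun_iff_map_fun_eq_pi_map fun i => (hZ_meas (e i)).aemeasurable).mp
    (hZ_indep.precomp he)]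
  simp_rw [hZ_map]

theorem measureReal_sample_mem {n : ℕ} {e : Fin n → ℕ} (he : Function.Injective e)
    {S : Set (Fin n → unitInterval × unitInterval)} (hS : MeasurableSet S) :
    P.real {ω | (fun i => Z (e i) ω) ∈ S}
      = (Measure.pi fun _ : Fin n => C.measure).real S := by
  rw [← map_sample hZ_meas hZ_indep hZ_map he,
    map_measureReal_apply (measurable_pi_lambda _ fun i => hZ_meas (e i)) hS]
  rfl

theorem measureReal_generatedProcess (n : ℕ) (σ : Equiv.Perm (Fin n)) :
    P.real {ω | generatedProcess Z n ω = σ} = copulaFreq C σ :=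
  measureReal_sample_mem hZ_meas hZ_indep hZ_map Fin.val_injective (measurableSet_orderPerm_eq σ)

omit [IsProbabilityMeasure P] hZ_indep hZ_map in
theorem measurableSet_generatedProcess_eq (n : ℕ) (σ : Equiv.Perm (Fin n)) :
    MeasurableSet {ω | generatedProcess Z n ω = σ} :=
  (measurable_pi_lambda (fun ω (i : Fin n) => Z i ω) fun i => hZ_meas i)
    (measurableSet_orderPerm_eq σ)

end Sample

/-! ### The generated process -/

theorem measureReal_congr_of_ae_iff {Ω : Type*} [MeasurableSpace Ω] {P : Measure Ω}
    {s t : Set Ω} (h : ∀ᵐ ω ∂P, ω ∈ s ↔ ω ∈ t) : P.real s = P.real t :=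
  measureReal_congr (eventuallyEq_set.mpr h)

/-- The rank permutation of the first components of `Z 0, …, Z (n - 1)`. -/
noncomputable def sampleRank {Ω : Type*} (Z : ℕ → Ω → unitInterval × unitInterval) (n : ℕ) (ω : Ω) :
    Equiv.Perm (Fin n) :=
  rankPerm fun i : Fin n => (Z i ω).1

/-- The successive permutations generated by `n` points whose first components have the ranks
`ρ` and whose permutation is `σ`. -/
def historyOf {n : ℕ} (ρ σ : Equiv.Perm (Fin n)) : (k : Fin (n + 1)) → Equiv.Perm (Fin k) :=
  fun k => orderPerm fun i : Fin k =>
    (ρ (Fin.castLE (Nat.lt_succ_iff.mp k.2) i), σ (ρ (Fin.castLE (Nat.lt_succ_iff.mp k.2) i)))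

section Pathwise

variable {Ω : Type*} {Z : ℕ → Ω → unitInterval × unitInterval} {ω : Ω}

theorem history_generatedProcess (hω : NoTies fun i => Z i ω) (n : ℕ) :
    (fun k : Fin (n + 1) => generatedProcess Z k ω)
      = historyOf (sampleRank Z n ω) (generatedProcess Z n ω) :=
  funext fun k => orderPerm_comp_eq (hω.comp Fin.val_injective)
    (Fin.castLE_injective (Nat.lt_succ_iff.mp k.2))

theorem sampleRank_eq_deletePerm (hω : NoTies fun i => Z i ω) (n : ℕ) :
    sampleRank Z n ω = deletePerm (sampleRank Z (n + 1) ω) (Fin.last n) :=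
  rankPerm_castSucc (x := fun i : Fin (n + 1) => (Z i ω).1) (hω.1.comp Fin.val_injective)

theorem generatedProcess_eq_deletePerm (hω : NoTies fun i => Z i ω) (n : ℕ) :
    generatedProcess Z n ω
      = deletePerm (generatedProcess Z (n + 1) ω) (sampleRank Z (n + 1) ω (Fin.last n)) :=
  orderPerm_castSucc (z := fun i : Fin (n + 1) => Z i ω) (hω.comp Fin.val_injective)

end Pathwise

section Sample

variable {Ω : Type*} [MeasurableSpace Ω] {P : Measure Ω} [IsProbabilityMeasure P]
  {C : Copula} {Z : ℕ → Ω → unitInterval × unitInterval}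
  (hZ_meas : ∀ i, Measurable (Z i)) (hZ_indep : iIndepFun Z P)
  (hZ_map : ∀ i, P.map (Z i) = C.measure)

include hZ_meas

omit [IsProbabilityMeasure P] in
theorem measurableSet_sampleRank_eq (n : ℕ) (ρ : Equiv.Perm (Fin n)) :
    MeasurableSet {ω | sampleRank Z n ω = ρ} :=
  (measurable_pi_lambda (fun ω (i : Fin n) => (Z i ω).1) fun i => (hZ_meas i).fst)
    (measurableSet_rankPerm_eq ρ)

include hZ_indep hZ_map

/-- Relabelling the points preserves their joint law and the associated permutation but acts
transitively on the ranks, so all n! rank permutations are equally likely given Π_n. -/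
theorem measureReal_sampleRank_inter (n : ℕ) (ρ σ : Equiv.Perm (Fin n)) :
    P.real ({ω | sampleRank Z n ω = ρ} ∩ {ω | generatedProcess Z n ω = σ})
      = copulaFreq C σ / n.factorial := by
  have hinv : ∀ ρ' : Equiv.Perm (Fin n),
      P.real ({ω | sampleRank Z n ω = ρ'} ∩ {ω | generatedProcess Z n ω = σ})
        = P.real ({ω | sampleRank Z n ω = ρ} ∩ {ω | generatedProcess Z n ω = σ}) := by
    intro ρ'
    let S : Set (Fin n → unitInterval × unitInterval) :=
      (fun z i => (z i).1) ⁻¹' {x | rankPerm x = ρ} ∩ {z | orderPerm z = σ}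
    have hS : MeasurableSet S :=
      ((measurable_pi_lambda _ fun i => measurable_fst.comp (measurable_pi_apply i))
        (measurableSet_rankPerm_eq _)).inter (measurableSet_orderPerm_eq σ)
    let g : Equiv.Perm (Fin n) := ρ'⁻¹ * ρ
    have h1 := measureReal_sample_mem hZ_meas hZ_indep hZ_map
      (e := fun i : Fin n => (g i : ℕ)) (Fin.val_injective.comp g.injective) hS
    have h2 := measureReal_sample_mem hZ_meas hZ_indep hZ_map
      (e := fun i : Fin n => (i : ℕ)) Fin.val_injective hS
    refine Eq.trans (measureReal_congr_of_ae_iff ?_) (h1.trans h2.symm)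
    filter_upwards [ae_noTies hZ_meas hZ_indep hZ_map] with ω hω
    have hn : NoTies fun i : Fin n => Z i ω := hω.comp Fin.val_injective
    have h3 := rankPerm_comp_perm hn.1 g
    have h4 := orderPerm_comp_perm hn g
    change sampleRank Z n ω = ρ' ∧ generatedProcess Z n ω = σ ↔
      rankPerm (fun i => (Z (g i) ω).1) = ρ ∧ orderPerm (fun i => Z (g i) ω) = σ
    rw [h3, h4]
    refine and_congr_left fun _ => ?_
    change sampleRank Z n ω = ρ' ↔ sampleRank Z n ω * (ρ'⁻¹ * ρ) = ρ
    rw [← mul_assoc, mul_eq_right, mul_inv_eq_one]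
  have h := sum_measureReal_inter_fiber P (measurableSet_sampleRank_eq hZ_meas n)
    {ω | generatedProcess Z n ω = σ}
  rw [measureReal_generatedProcess hZ_meas hZ_indep hZ_map] at h
  rw [← h]
  simp_rw [inter_comm {ω | generatedProcess Z n ω = σ}]
  rw [Finset.sum_congr rfl fun ρ' _ => hinv ρ', Finset.sum_const, Finset.card_univ,
    Fintype.card_perm, Fintype.card_fin, nsmul_eq_mul, mul_div_cancel_left₀]
  positivity

/-- The ranks and Π at time n + 1 determine those at time n; the admissible ranks ρ' are counted by
`card_deletePerm_eq`. The result does not involve ρ. -/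
theorem measureReal_sampleRank_inter_succ (n : ℕ) (ρ σ : Equiv.Perm (Fin n))
    (τ : Equiv.Perm (Fin (n + 1))) :
    P.real ({ω | sampleRank Z n ω = ρ} ∩ {ω | generatedProcess Z n ω = σ}
        ∩ {ω | generatedProcess Z (n + 1) ω = τ})
      = deletionCount σ τ * (copulaFreq C τ / (n + 1).factorial) := by
  rw [← sum_measureReal_inter_fiber P (measurableSet_sampleRank_eq hZ_meas (n + 1))]
  have h : ∀ ρ' : Equiv.Perm (Fin (n + 1)),
      P.real ({ω | sampleRank Z n ω = ρ} ∩ {ω | generatedProcess Z n ω = σ}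
        ∩ {ω | generatedProcess Z (n + 1) ω = τ} ∩ {ω | sampleRank Z (n + 1) ω = ρ'})
        = if deletePerm ρ' (Fin.last n) = ρ ∧ deletePerm τ (ρ' (Fin.last n)) = σ then
            copulaFreq C τ / (n + 1).factorial else 0 := by
    intro ρ'
    rw [← measureReal_sampleRank_inter hZ_meas hZ_indep hZ_map (n + 1) ρ' τ]
    split_ifs with hc
    · refine measureReal_congr_of_ae_iff ?_
      filter_upwards [ae_noTies hZ_meas hZ_indep hZ_map] with ω hω
      simp only [mem_inter_iff, mem_ofPred_eq]
      refine ⟨fun h => ⟨h.2, h.1.2⟩, fun h => ⟨⟨⟨?_, ?_⟩, h.2⟩, h.1⟩⟩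
      · rw [sampleRank_eq_deletePerm hω, h.1, hc.1]
      · rw [generatedProcess_eq_deletePerm hω, h.1, h.2, hc.2]
    · rw [← measureReal_empty (μ := P)]
      refine measureReal_congr_of_ae_iff ?_
      filter_upwards [ae_noTies hZ_meas hZ_indep hZ_map] with ω hω
      simp only [mem_inter_iff, mem_ofPred_eq, mem_empty_iff_false, iff_false]
      rintro ⟨⟨⟨h1, h2⟩, h3⟩, h4⟩
      refine hc ⟨?_, ?_⟩
      · rw [← h4, ← sampleRank_eq_deletePerm hω, h1]
      · rw [← h3, ← h4, ← generatedProcess_eq_deletePerm hω, h2]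
  rw [Finset.sum_congr rfl fun ρ' _ => h ρ', ← Finset.sum_filter, Finset.sum_const,
    card_deletePerm_eq, nsmul_eq_mul]

open Classical in
theorem isDeletionChain_generatedProcess : IsDeletionChain P (generatedProcess Z) := by
  -- Given Π_n = σ, the past is a function of the ranks ρ. If `D` has the same weight `r` for every
  -- ρ, a past event contributes only the number of ρ compatible with it.
  have hE : ∀ (n : ℕ) (S : Set ((k : Fin (n + 1)) → Equiv.Perm (Fin k)))
      (σ : Equiv.Perm (Fin n)) (D : Set Ω) (r : ℝ),
      (∀ ρ, P.real ({ω | sampleRank Z n ω = ρ} ∩ {ω | generatedProcess Z n ω = σ} ∩ D) = r) →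
      P.real ({ω | (fun k : Fin (n + 1) => generatedProcess Z k ω) ∈ S}
        ∩ {ω | generatedProcess Z n ω = σ} ∩ D)
        = (Finset.univ.filter fun ρ => historyOf ρ σ ∈ S).card * r := by
    intro n S σ D r hr
    rw [← sum_measureReal_inter_fiber P (measurableSet_sampleRank_eq hZ_meas n)]
    have h : ∀ ρ : Equiv.Perm (Fin n),
        P.real ({ω | (fun k : Fin (n + 1) => generatedProcess Z k ω) ∈ S}
          ∩ {ω | generatedProcess Z n ω = σ} ∩ D ∩ {ω | sampleRank Z n ω = ρ})
          = if historyOf ρ σ ∈ S then r else 0 := by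
      intro ρ
      rw [← hr ρ]
      split_ifs with hc
      · refine measureReal_congr_of_ae_iff ?_
        filter_upwards [ae_noTies hZ_meas hZ_indep hZ_map] with ω hω
        simp only [mem_inter_iff, mem_ofPred_eq, history_generatedProcess hω]
        constructor
        · rintro ⟨⟨⟨-, h2⟩, h3⟩, h4⟩
          exact ⟨⟨h4, h2⟩, h3⟩
        · rintro ⟨⟨h4, h2⟩, h3⟩
          exact ⟨⟨⟨by rwa [h4, h2], h2⟩, h3⟩, h4⟩
      · rw [← measureReal_empty (μ := P)]
        refine measureReal_congr_of_ae_iff ?_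
        filter_upwards [ae_noTies hZ_meas hZ_indep hZ_map] with ω hω
        simp only [mem_inter_iff, mem_ofPred_eq, mem_empty_iff_false, iff_false,
          history_generatedProcess hω]
        rintro ⟨⟨⟨h1, h2⟩, -⟩, h4⟩
        exact hc (by rwa [h4, h2] at h1)
    rw [Finset.sum_congr rfl fun ρ _ => h ρ, ← Finset.sum_filter, Finset.sum_const, nsmul_eq_mul]
  have hj : ∀ (n : ℕ) (σ : Equiv.Perm (Fin n)) (τ : Equiv.Perm (Fin (n + 1))),
      P.real ({ω | generatedProcess Z n ω = σ} ∩ {ω | generatedProcess Z (n + 1) ω = τ})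
        = deletionCount σ τ / ((n : ℝ) + 1) * copulaFreq C τ := by
    intro n σ τ
    have h := hE n univ σ {ω | generatedProcess Z (n + 1) ω = τ} _ fun ρ =>
      measureReal_sampleRank_inter_succ hZ_meas hZ_indep hZ_map n ρ σ τ
    simp only [mem_univ, ofPred_true, univ_inter, Finset.filter_true, Finset.card_univ,
      Fintype.card_perm, Fintype.card_fin, Nat.factorial_succ] at h
    rw [h]
    push_cast
    field_simp
  refine ⟨measurableSet_generatedProcess_eq hZ_meas, ?_, ?_⟩
  · intro n _ S σ τ
    have h1 := hE n S σ {ω | generatedProcess Z (n + 1) ω = τ} _ fun ρ =>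
      measureReal_sampleRank_inter_succ hZ_meas hZ_indep hZ_map n ρ σ τ
    have h2 := hE n S σ univ (copulaFreq C σ / n.factorial) fun ρ => by
      rw [inter_univ, measureReal_sampleRank_inter hZ_meas hZ_indep hZ_map]
    rw [inter_univ] at h2
    rw [h1, h2, hj, measureReal_generatedProcess hZ_meas hZ_indep hZ_map, Nat.factorial_succ]
    push_cast
    field_simp
  · intro n _ σ τ
    rw [hj, measureReal_generatedProcess hZ_meas hZ_indep hZ_map]

end Sample

/-! ### Convergence of the generated permutations to the copula -/

theorem copulaFreq_nonneg (C : Copula) {k : ℕ} (σ : Equiv.Perm (Fin k)) : 0 ≤ copulaFreq C σ :=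
  measureReal_nonneg

section Sample

variable {Ω : Type*} [MeasurableSpace Ω] {P : Measure Ω} [IsProbabilityMeasure P]
  {C : Copula} {Z : ℕ → Ω → unitInterval × unitInterval}
  (hZ_meas : ∀ i, Measurable (Z i)) (hZ_indep : iIndepFun Z P)
  (hZ_map : ∀ i, P.map (Z i) = C.measure)

include hZ_meas

omit [IsProbabilityMeasure P] in
theorem measurableSet_orderPerm_sample_eq {k : ℕ} (e : Fin k → ℕ) (σ : Equiv.Perm (Fin k)) :
    MeasurableSet {ω | orderPerm (fun i => Z (e i) ω) = σ} :=
  (measurable_pi_lambda (fun ω i => Z (e i) ω) fun i => hZ_meas (e i))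
    (measurableSet_orderPerm_eq σ)

include hZ_indep hZ_map

/-- By exchangeability any k of the first n points relate to Π_n as the first k do; `g` below is a
relabelling that carries the first k indices to `e`. -/
theorem measureReal_orderPerm_inter {k n : ℕ} (hk : 1 ≤ k) {e : Fin k → ℕ}
    (he : Function.Injective e) (hen : ∀ i, e i < n) (σ : Equiv.Perm (Fin k))
    (τ : Equiv.Perm (Fin n)) :
    P.real ({ω | orderPerm (fun i => Z (e i) ω) = σ} ∩ {ω | generatedProcess Z n ω = τ})
      = patternFreq σ τ * copulaFreq C τ := by
  let e' : Fin k → Fin n := fun i => ⟨e i, hen i⟩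
  have he' : Function.Injective e' := fun i j h => he (congrArg Fin.val h)
  have hkn : k ≤ n := by simpa using Fintype.card_le_of_injective e' he'
  obtain ⟨g, hg⟩ := Equiv.Perm.exists_extending_pair (Fin.castLE hkn) e'
    (Fin.castLE_injective hkn) he'
  let S : Set (Fin n → unitInterval × unitInterval) :=
    (fun z i => z (Fin.castLE hkn i)) ⁻¹' {z : Fin k → unitInterval × unitInterval | orderPerm z = σ}
      ∩ {z | orderPerm z = τ}
  have hS : MeasurableSet S :=
    ((measurable_pi_lambda _ fun i => measurable_pi_apply (Fin.castLE hkn i))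
      (measurableSet_orderPerm_eq σ)).inter (measurableSet_orderPerm_eq τ)
  have h1 := measureReal_sample_mem hZ_meas hZ_indep hZ_map
    (e := fun i : Fin n => (g i : ℕ)) (Fin.val_injective.comp g.injective) hS
  have h2 := measureReal_sample_mem hZ_meas hZ_indep hZ_map
    (e := fun i : Fin n => (i : ℕ)) Fin.val_injective hS
  rw [← measureReal_generatedProcess hZ_meas hZ_indep hZ_map,
    ← (isDeletionChain_generatedProcess hZ_meas hZ_indep hZ_map).measureReal_inter hk hkn]
  refine Eq.trans (measureReal_congr_of_ae_iff ?_) (h1.trans h2.symm)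
  filter_upwards [ae_noTies hZ_meas hZ_indep hZ_map] with ω hω
  have hn : NoTies fun i : Fin n => Z i ω := hω.comp Fin.val_injective
  have h3 := orderPerm_comp_perm hn g
  change orderPerm (fun i => Z (e i) ω) = σ ∧ generatedProcess Z n ω = τ ↔
    orderPerm (fun i => Z (g (Fin.castLE hkn i)) ω) = σ ∧ orderPerm (fun i => Z (g i) ω) = τ
  rw [h3]
  simp_rw [hg]
  rfl

/-- The indicator of the event that the `b`-th block of `k` points leads to `σ`. -/
noncomputable def blockIndicator (Z : ℕ → Ω → unitInterval × unitInterval) {k : ℕ}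
    (σ : Equiv.Perm (Fin k)) (b : ℕ) (ω : Ω) : ℝ :=
  {z : Fin k → unitInterval × unitInterval | orderPerm z = σ}.indicator (fun _ => (1 : ℝ))
    fun i => Z (b * k + i) ω

omit hZ_meas hZ_indep hZ_map [MeasurableSpace Ω] in
theorem blockIndicator_eq {k : ℕ} (σ : Equiv.Perm (Fin k)) (b : ℕ) :
    blockIndicator Z σ b
      = {ω | orderPerm (fun i : Fin k => Z (b * k + i) ω) = σ}.indicator 1 := rfl

omit hZ_indep hZ_map [IsProbabilityMeasure P] in
theorem measurable_blockIndicator {k : ℕ} (σ : Equiv.Perm (Fin k)) (b : ℕ) :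
    Measurable (blockIndicator Z σ b) := by
  rw [blockIndicator_eq]
  exact measurable_one.indicator
    (measurableSet_orderPerm_sample_eq hZ_meas (fun i : Fin k => b * k + i) σ)

omit hZ_indep hZ_map in
theorem memLp_blockIndicator {k : ℕ} (σ : Equiv.Perm (Fin k)) (b : ℕ) :
    MemLp (blockIndicator Z σ b) 1 P := by
  refine MemLp.of_bound (measurable_blockIndicator hZ_meas σ b).aestronglyMeasurable 1
    (Eventually.of_forall fun ω => ?_)
  rw [blockIndicator_eq]
  refine (norm_indicator_le_norm_self _ _).trans ?_
  simp

/-- Disjoint blocks give independent, identically distributed indicators of mean t(σ, C), so the law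
of large numbers in L¹ applies. -/
theorem tendsto_integral_blockIndicator {k : ℕ} (σ : Equiv.Perm (Fin k)) :
    Tendsto (fun N : ℕ => ∫ ω, |(N : ℝ)⁻¹ * ∑ b ∈ Finset.range N, blockIndicator Z σ b ω
      - copulaFreq C σ| ∂P) atTop (𝓝 0) := by
  have hinj : ∀ b, Function.Injective fun i : Fin k => b * k + (i : ℕ) := fun b i j h =>
    Fin.ext (Nat.add_left_cancel h)
  have hψ : Measurable ({z : Fin k → unitInterval × unitInterval | orderPerm z = σ}.indicator
      (fun _ => (1 : ℝ))) := measurable_const.indicator (measurableSet_orderPerm_eq σ)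
  have hident : ∀ b, IdentDistrib (blockIndicator Z σ b) (blockIndicator Z σ 0) P P := by
    intro b
    have h : IdentDistrib (fun ω (i : Fin k) => Z (b * k + i) ω)
        (fun ω (i : Fin k) => Z (0 * k + i) ω) P P :=
      ⟨(measurable_pi_lambda _ fun i => hZ_meas _).aemeasurable,
        (measurable_pi_lambda _ fun i => hZ_meas _).aemeasurable, by
        rw [map_sample hZ_meas hZ_indep hZ_map (hinj b),
          map_sample hZ_meas hZ_indep hZ_map (hinj 0)]⟩
    exact h.comp hψ
  have hindep : Pairwise (Function.onFun (fun f g => IndepFun f g P) (blockIndicator Z σ)) := by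
    intro b b' hbb
    let S : ℕ → Finset ℕ := fun b => Finset.univ.image fun i : Fin k => b * k + (i : ℕ)
    have hS : ∀ b (i : Fin k), b * k + (i : ℕ) ∈ S b := fun b i =>
      Finset.mem_image_of_mem _ (Finset.mem_univ i)
    have hdisj : Disjoint (S b) (S b') := by
      rw [Finset.disjoint_left]
      intro m hm hm'
      obtain ⟨i, -, rfl⟩ := Finset.mem_image.mp hm
      obtain ⟨j, -, hj⟩ := Finset.mem_image.mp hm'
      have hdiv : ∀ (c : ℕ) (l : Fin k), (c * k + l) / k = c := fun c l => by
        rw [mul_comm, Nat.mul_add_div l.pos, Nat.div_eq_of_lt l.2, add_zero]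
      exact hbb (by rw [← hdiv b i, ← hj, hdiv])
    have hφ : ∀ b, Measurable fun g : S b → unitInterval × unitInterval =>
        {z : Fin k → unitInterval × unitInterval | orderPerm z = σ}.indicator
          (fun _ => (1 : ℝ)) fun i => g ⟨b * k + i, hS b i⟩ := fun b =>
      hψ.comp (measurable_pi_lambda _ fun i => measurable_pi_apply _)
    exact (hZ_indep.indepFun_finset (S b) (S b') hdisj hZ_meas).comp (hφ b) (hφ b')
  have hmean : ∫ ω, blockIndicator Z σ 0 ω ∂P = copulaFreq C σ := by
    rw [blockIndicator_eq, integral_indicator_one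
      (measurableSet_orderPerm_sample_eq hZ_meas (fun i : Fin k => 0 * k + i) σ)]
    exact measureReal_sample_mem hZ_meas hZ_indep hZ_map (hinj 0) (measurableSet_orderPerm_eq σ)
  have h := strong_law_Lp le_rfl ENNReal.one_ne_top (blockIndicator Z σ)
    (memLp_blockIndicator hZ_meas σ 0) hindep hident
  rw [hmean] at h
  have h' := (ENNReal.tendsto_toReal ENNReal.zero_ne_top).comp h
  refine h'.congr fun N => ?_
  have hm : Measurable fun ω => (N : ℝ)⁻¹ • ∑ b ∈ Finset.range N, blockIndicator Z σ b ω
      - copulaFreq C σ :=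
    ((Finset.measurable_sum (Finset.range N) fun b _ =>
      measurable_blockIndicator hZ_meas σ b).const_mul _).sub_const _
  rw [Function.comp_apply, eLpNorm_one_eq_lintegral_enorm,
    ← integral_norm_eq_lintegral_enorm hm.aestronglyMeasurable]
  rfl

/-- Given Π_n, the block average has mean t(σ, Π_n), because all N blocks lie among the first n
points. The bound is then |E f| ≤ E |f| on each event Π_n = τ. -/
theorem sum_abs_patternFreq_sub_le {k N n : ℕ} (hk : 1 ≤ k) (hN : 0 < N) (hn : N * k ≤ n)
    (σ : Equiv.Perm (Fin k)) :
    ∑ τ : Equiv.Perm (Fin n), copulaFreq C τ * |patternFreq σ τ - copulaFreq C σ|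
      ≤ ∫ ω, |(N : ℝ)⁻¹ * ∑ b ∈ Finset.range N, blockIndicator Z σ b ω - copulaFreq C σ| ∂P := by
  have hint : ∀ b, Integrable (blockIndicator Z σ b) P := fun b =>
    memLp_one_iff_integrable.mp (memLp_blockIndicator hZ_meas σ b)
  have hs : Integrable (fun ω => (N : ℝ)⁻¹ * ∑ b ∈ Finset.range N, blockIndicator Z σ b ω) P :=
    (integrable_finsetSum _ fun b _ => hint b).const_mul _
  have hd : Integrable (fun ω => (N : ℝ)⁻¹ * ∑ b ∈ Finset.range N, blockIndicator Z σ b ω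
      - copulaFreq C σ) P := hs.sub (integrable_const _)
  have hset := measurableSet_generatedProcess_eq hZ_meas n
  have hU : ⋃ τ, {ω | generatedProcess Z n ω = τ} = univ := by
    ext ω
    simp
  rw [← setIntegral_univ, ← hU, integral_iUnion_fintype hset ?_ fun τ => hd.abs.integrableOn]
  · refine Finset.sum_le_sum fun τ _ => ?_
    refine le_trans (le_of_eq ?_) (abs_integral_le_integral_abs)
    have hb : ∀ b ∈ Finset.range N, ∫ ω in {ω | generatedProcess Z n ω = τ},
        blockIndicator Z σ b ω ∂P = patternFreq σ τ * copulaFreq C τ := by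
      intro b hb
      have hm := measurableSet_orderPerm_sample_eq hZ_meas (fun i : Fin k => b * k + i) σ
      rw [blockIndicator_eq, integral_indicator_one hm, measureReal_restrict_apply hm]
      refine measureReal_orderPerm_inter hZ_meas hZ_indep hZ_map hk
        (fun i j h => Fin.ext (Nat.add_left_cancel h)) (fun i => ?_) σ τ
      calc b * k + i < b * k + k := Nat.add_lt_add_left i.2 _
        _ = (b + 1) * k := (Nat.succ_mul b k).symm
        _ ≤ N * k := Nat.mul_le_mul_right k (Finset.mem_range.mp hb)
        _ ≤ n := hn
    rw [integral_sub hs.integrableOn (integrable_const _), integral_const_mul,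
      integral_finsetSum _ fun b _ => (hint b).integrableOn, Finset.sum_congr rfl hb,
      Finset.sum_const, Finset.card_range, nsmul_eq_mul, setIntegral_const,
      measureReal_generatedProcess hZ_meas hZ_indep hZ_map, smul_eq_mul,
      inv_mul_cancel_left₀ (by exact_mod_cast hN.ne'), mul_comm (patternFreq σ τ), ← mul_sub,
      abs_mul, abs_of_nonneg (copulaFreq_nonneg C τ)]
  · intro τ τ' h
    rw [Function.onFun, Set.disjoint_left]
    rintro ω rfl h'
    exact h h'

theorem tendsto_sum_abs_patternFreq_sub {k : ℕ} (hk : 1 ≤ k) (σ : Equiv.Perm (Fin k)) :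
    Tendsto (fun n : ℕ => ∑ τ : Equiv.Perm (Fin n),
      copulaFreq C τ * |patternFreq σ τ - copulaFreq C σ|) atTop (𝓝 0) := by
  have h1 := tendsto_integral_blockIndicator hZ_meas hZ_indep hZ_map σ
  have h2 : Tendsto (fun n : ℕ => n / k) atTop atTop :=
    Nat.tendsto_div_const_atTop (Nat.one_le_iff_ne_zero.mp hk)
  refine squeeze_zero' (Eventually.of_forall fun n => Finset.sum_nonneg fun τ _ =>
    mul_nonneg (copulaFreq_nonneg C τ) (abs_nonneg _)) ?_ (h1.comp h2)
  filter_upwards [eventually_ge_atTop k] with n hn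
  exact sum_abs_patternFreq_sub_le hZ_meas hZ_indep hZ_map hk (Nat.div_pos hn hk)
    (Nat.div_mul_le_self n k) σ

theorem sum_copulaFreq (n : ℕ) : ∑ τ : Equiv.Perm (Fin n), copulaFreq C τ = 1 := by
  have h := sum_measureReal_inter_fiber P (measurableSet_generatedProcess_eq hZ_meas n) univ
  rw [probReal_univ] at h
  rw [← h]
  refine Finset.sum_congr rfl fun τ _ => ?_
  rw [univ_inter, measureReal_generatedProcess hZ_meas hZ_indep hZ_map]

theorem copulaFreq_mem_patternClosure :
    (fun x : AllPerm => copulaFreq C x.perm) ∈ patternClosure univ := by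
  rw [patternClosure, mem_closure_iff_nhds]
  intro U hU
  rw [nhds_pi, Filter.mem_pi] at hU
  obtain ⟨I, hI, s, hs, hsU⟩ := hU
  choose ε hε hεs using fun x => Metric.mem_nhds_iff.mp (hs x)
  lift I to Finset AllPerm using hI
  -- With weights 1/ε(x), a total below 1 puts every coordinate in `I` within its own tolerance.
  have ht : Tendsto (fun n : ℕ => ∑ x ∈ I, (ε x)⁻¹ * ∑ τ : Equiv.Perm (Fin n),
      copulaFreq C τ * |patternFreq x.perm τ - copulaFreq C x.perm|) atTop (𝓝 0) := by
    have := tendsto_finsetSum I fun x _ =>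
      (tendsto_sum_abs_patternFreq_sub hZ_meas hZ_indep hZ_map x.size_pos x.perm).const_mul
        (ε x)⁻¹
    simpa using this
  obtain ⟨n, hn1, hn⟩ := ((eventually_ge_atTop 1).and (ht.eventually_lt_const one_pos)).exists
  -- The average with weights t(τ, C), which sum to 1, is below 1; hence some τ has a value below 1.
  obtain ⟨τ, hτ⟩ : ∃ τ : Equiv.Perm (Fin n),
      ∑ x ∈ I, (ε x)⁻¹ * |patternFreq x.perm τ - copulaFreq C x.perm| < 1 := by
    by_contra! hcon
    refine hn.not_ge ?_
    rw [← sum_copulaFreq hZ_meas hZ_indep hZ_map (C := C) n]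
    simp_rw [Finset.mul_sum]
    rw [Finset.sum_comm]
    refine Finset.sum_le_sum fun τ _ => ?_
    refine (le_mul_of_one_le_right (copulaFreq_nonneg C τ) (hcon τ)).trans (le_of_eq ?_)
    rw [Finset.mul_sum]
    exact Finset.sum_congr rfl fun x _ => by ring
  refine ⟨patternEmb ⟨n, hn1, τ⟩, hsU fun x hx => hεs x ?_, mem_image_of_mem _ (mem_univ _)⟩
  rw [Metric.mem_ball, Real.dist_eq]
  have h := (Finset.single_le_sum
    (f := fun x => (ε x)⁻¹ * |patternFreq x.perm τ - copulaFreq C x.perm|)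
    (fun x _ => mul_nonneg (inv_nonneg.mpr (hε x).le) (abs_nonneg _)) hx).trans_lt hτ
  rwa [inv_mul_lt_one₀ (hε x)] at h

theorem copulaFreq_ne_patternEmb (y : AllPerm) :
    (fun x : AllPerm => copulaFreq C x.perm) ≠ patternEmb y := by
  intro h
  have h1 := sum_copulaFreq hZ_meas hZ_indep hZ_map (y.size + 1)
  rw [Finset.sum_eq_zero fun τ _ => ?_] at h1
  · exact zero_ne_one h1
  · have h2 := congrFun h ⟨y.size + 1, Nat.le_add_left 1 _, τ⟩
    exact h2.trans (patternFreq_of_lt (Nat.lt_succ_self _) _ _)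

end Sample

/-! ### The h-transform and the theorem -/

theorem mainTheorem1
    {Ω : Type*} [MeasurableSpace Ω] (P : Measure Ω) [IsProbabilityMeasure P]
    (C : Copula) (Z : ℕ → Ω → unitInterval × unitInterval)
    (hZ_meas : ∀ i, Measurable (Z i)) (hZ_indep : iIndepFun Z P)
    (hZ_law : ∀ i u v, P.real {ω | (Z i ω).1 ≤ u ∧ (Z i ω).2 ≤ v} = (C.toFun u v : ℝ))
    {Ω' : Type*} [MeasurableSpace Ω'] (Q : Measure Ω') [IsProbabilityMeasure Q]
    (A B : (n : ℕ) → Ω' → Fin (n + 1))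
    (hA_meas : ∀ n, Measurable (A n)) (hB_meas : ∀ n, Measurable (B n))
    (hA_unif : ∀ n i, Q.real {ω | A n ω = i} = 1 / ((n : ℝ) + 1))
    (hB_unif : ∀ n j, Q.real {ω | B n ω = j} = 1 / ((n : ℝ) + 1))
    (hAB_indep : ∀ n, IndepFun (A n) (B n) Q)
    (hsteps_indep : iIndepFun (fun n ω => (A n ω, B n ω)) Q) :
    -- the generated process is a Markov chain with the stated transition probabilities
    (IsMarkovChain P (generatedProcess Z) ∧
      ∀ n : ℕ, 1 ≤ n → ∀ (σ : Equiv.Perm (Fin n)) (τ : Equiv.Perm (Fin (n + 1))),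
        P {ω | generatedProcess Z n ω = σ} ≠ 0 →
        0 < copulaFreq C σ ∧
        transProb P (generatedProcess Z) σ τ
          = ((n : ℝ) + 1) * copulaFreq C τ / copulaFreq C σ
              * transProb Q (doubleInsertion A B) σ τ) ∧
    -- its Doob-Martin topology is the pattern frequency topology
    (∃ Φ : martinCompactification P (generatedProcess Z) ≃ₜ
        patternClosure (stateSpace P (generatedProcess Z)),
      IsIdentification P (generatedProcess Z) Φ) ∧
    -- it is the h-transform of the double insertion chain for the boundary point `C`
    stateSpace Q (doubleInsertion A B) = univ ∧
    (∀ x : AllPerm,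
      ContinuousOn (martinKernelExt Q (doubleInsertion A B) x)
        (martinCompactification Q (doubleInsertion A B)) ∧
      ∀ y, martinKernelExt Q (doubleInsertion A B) x (martinEmb Q (doubleInsertion A B) y)
        = martinKernel Q (doubleInsertion A B) x y) ∧
    ∃ Φ : martinCompactification Q (doubleInsertion A B) ≃ₜ
        patternClosure (stateSpace Q (doubleInsertion A B)),
      IsIdentification Q (doubleInsertion A B) Φ ∧
      ∃ c : martinCompactification Q (doubleInsertion A B),
        c.1 ∈ martinBoundary Q (doubleInsertion A B) ∧
        (∀ x : AllPerm, (Φ c : AllPerm → ℝ) x = copulaFreq C x.perm) ∧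
        (∀ x : AllPerm, martinKernelExt Q (doubleInsertion A B) x c
          = (x.size.factorial : ℝ) * copulaFreq C x.perm) ∧
        IsHTransform P (generatedProcess Z) Q (doubleInsertion A B)
          (fun x => martinKernelExt Q (doubleInsertion A B) x c) := by
  have hZ_map : ∀ i, P.map (Z i) = C.measure := fun i =>
    map_eq_copula_measure (hZ_meas i) (hZ_law i)
  have hX := isDeletionChain_generatedProcess hZ_meas hZ_indep hZ_map
  have hXw := measureReal_generatedProcess hZ_meas hZ_indep hZ_map
  have hY := isDeletionChain_doubleInsertion hA_meas hB_meas hA_unif hB_unif hAB_indep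
    hsteps_indep
  have hYw := measureReal_doubleInsertion hA_meas hB_meas hA_unif hB_unif hAB_indep hsteps_indep
  have hS : stateSpace Q (doubleInsertion A B) = univ := stateSpace_eq_univ_of_uniform hYw
  have hmem : ∀ x, x ∈ stateSpace Q (doubleInsertion A B) := fun x => hS ▸ mem_univ x
  have hext : ∀ x α, α ∈ martinCompactification Q (doubleInsertion A B) →
      martinKernelExt Q (doubleInsertion A B) x α = x.size.factorial * α ⟨x, hmem x⟩ :=
    fun x _ hα => hY.martinKernelExt_eq_of_uniform hYw ⟨x, hmem x⟩ hα
  have hpos : ∀ {n : ℕ} (σ : Equiv.Perm (Fin n)),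
      P {ω | generatedProcess Z n ω = σ} ≠ 0 → 0 < copulaFreq C σ := fun σ h0 => by
    rw [← hXw]
    exact measureReal_nonneg.lt_of_ne' (ENNReal.toReal_ne_zero.mpr ⟨h0, measure_ne_top _ _⟩)
  have hYtrans : ∀ {n : ℕ}, 1 ≤ n → ∀ (σ : Equiv.Perm (Fin n)) (τ : Equiv.Perm (Fin (n + 1))),
      transProb Q (doubleInsertion A B) σ τ = deletionCount σ τ / ((n : ℝ) + 1) ^ 2 := by
    intro n hn σ τ
    rw [hY.transProb_eq hn, hYw, hYw, Nat.factorial_succ]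
    push_cast
    field_simp
  have htrans : ∀ n : ℕ, 1 ≤ n → ∀ (σ : Equiv.Perm (Fin n)) (τ : Equiv.Perm (Fin (n + 1))),
      P {ω | generatedProcess Z n ω = σ} ≠ 0 →
      transProb P (generatedProcess Z) σ τ
        = ((n : ℝ) + 1) * copulaFreq C τ / copulaFreq C σ
          * transProb Q (doubleInsertion A B) σ τ := by
    intro n hn σ τ h0
    have := (hpos σ h0).ne'
    rw [hX.transProb_eq hn, hYtrans hn, hXw, hXw]
    field_simp
  obtain ⟨Φ, hΦ, hΦc⟩ := hY.exists_isIdentification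
  have hC : (fun x : AllPerm => copulaFreq C x.perm) ∈
      patternClosure (stateSpace Q (doubleInsertion A B)) :=
    hS.symm ▸ copulaFreq_mem_patternClosure hZ_meas hZ_indep hZ_map
  -- The boundary point is t(·, C), carried back to the Doob-Martin compactification.
  let c := Φ.symm ⟨_, hC⟩
  have hcΦ : Φ c = ⟨_, hC⟩ := Φ.apply_symm_apply _
  have hc : ∀ x, c.1 ⟨x, hmem x⟩ = copulaFreq C x.perm := fun x => by
    rw [← hΦc c ⟨x, hmem x⟩, hcΦ]
  have hcK : ∀ x : AllPerm, martinKernelExt Q (doubleInsertion A B) x c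
      = (x.size.factorial : ℝ) * copulaFreq C x.perm := fun x => by
    rw [hext x c c.2, hc]
  refine ⟨⟨hX.isMarkovChain, fun n hn σ τ h0 => ⟨hpos σ h0, htrans n hn σ τ h0⟩⟩,
    hX.exists_isIdentification.imp fun _ h => h.1, hS, fun x => ⟨?_, fun y => ?_⟩,
    Φ, hΦ, c, ⟨c.2, ?_⟩, fun x => ?_, hcK,
    hY.isMarkovChain, hX.isMarkovChain, fun x _ => ?_, fun x _ => ?_, fun σ => ?_,
    fun x hx τ => ⟨?_, ?_⟩⟩
  · exact ((continuous_apply _).const_mul _).continuousOn.congr fun α hα => hext x α hα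
  · rw [hext x _ (martinEmb_mem _ _ y),
      hY.martinKernel_eq_of_uniform hYw ⟨x, hmem x⟩ y]
  · rintro ⟨y, hy⟩
    refine copulaFreq_ne_patternEmb hZ_meas hZ_indep hZ_map y.1 ?_
    have hy' : (⟨_, martinEmb_mem _ _ y⟩ :
        martinCompactification Q (doubleInsertion A B)) = c := Subtype.ext hy
    rw [← hΦ y, hy', hcΦ]
  · rw [hcΦ]
  · change 0 ≤ martinKernelExt Q (doubleInsertion A B) x c
    rw [hcK]
    exact mul_nonneg (Nat.cast_nonneg _) (copulaFreq_nonneg C _)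
  -- Harmonicity is total probability for Π: each summand is n! P(Π_n = σ, Π_{n+1} = τ).
  · simp only [hcK]
    have h := sum_measureReal_inter_fiber P (hX.measurableSet_eq (x.size + 1))
      {ω | generatedProcess Z x.size ω = x.perm}
    rw [hXw] at h
    rw [← h, Finset.mul_sum]
    refine Finset.sum_congr rfl fun τ _ => ?_
    rw [hX.joint _ x.size_pos, hYtrans x.size_pos, hXw, Nat.factorial_succ]
    push_cast
    field_simp
  · simp only [hcK]
    rw [hXw, hYw]
    simp
  · change 0 < martinKernelExt Q (doubleInsertion A B) x c
    rw [hcK]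
    exact mul_pos (by positivity) (hpos _ hx)
  · simp only [hcK]
    have := (hpos _ hx).ne'
    rw [htrans _ x.size_pos _ _ hx, Nat.factorial_succ]
    push_cast
    field_simp
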